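/- Theorem 4.1. All functions and distributions are complex-valued and pairings are bilinear. Let $\mathcal{S}_{od}(\mathbb{R}^2)$ be the space of all $G \in \mathcal{S}(\mathbb{R}^2)$ with $G(x,y) = -G(y,x)$ for all $x,y$ and $\partial_x^a \partial_y^b G(z,z) = 0$ for all $a,b \in \mathbb{N}_0$ and $z \in \mathbb{R}$, with the topology induced by $\mathcal{S}(\mathbb{R}^2)$, and let $\mathcal{S}'_{od}(\mathbb{R}^2)$ be its topological dual. For $G \in \mathcal{S}_{od}(\mathbb{R}^2)$ the $1/2$-divergence $$\operatorname{div}_{1/2} G(x) = \int_{\mathbb{R}} \frac{G(x,y) - G(y,x)}{|x-y|^{1/2}} \frac{dy}{|x-y|} = \int_{\mathbb{R}} \frac{2\,G(x,y)}{|x-y|^{1/2}} \frac{dy}{|x-y|}$$ is a Schwartz function on $\mathbb{R}$ that depends continuously on $G$. For a tempered distribution $u \in \mathcal{S}'(\mathbb{R})$ the distributional $1/2$-gradient $d_{1/2} u \in \mathcal{S}'_{od}(\mathbb{R}^2)$ is defined by $\langle d_{1/2} u, G \rangle = \langle u, \operatorname{div}_{1/2} G \rangle$. Let $L^1_{od}(\mathbb{R}^2)$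 be the space of (classes of) measurable $F : \mathbb{R}^2 \to \mathbb{C}$ with $F(x,y) = -F(y,x)$ for almost every $(x,y)$ and $\|F\|_{L^1_{od}} = \int_{\mathbb{R}} \int_{\mathbb{R}} |F(x,y)| \frac{dx\,dy}{|x-y|} < \infty$. Each $F \in L^1_{od}(\mathbb{R}^2)$ is identified with the element $G \mapsto \int_{\mathbb{R}} \int_{\mathbb{R}} F(x,y) G(x,y) \frac{dx\,dy}{|x-y|}$ of $\mathcal{S}'_{od}(\mathbb{R}^2)$. There is an absolute constant $K > 0$ such that the following holds. If $u \in \mathcal{S}'(\mathbb{R})$ satisfies $d_{1/2} u = F$ in $\mathcal{S}'_{od}(\mathbb{R}^2)$ for some $F \in L^1_{od}(\mathbb{R}^2)$, then there is a constant $C \in \mathbb{C}$ such that $u - C \in L^2(\mathbb{R})$ and $$\| u - C \|_{L^2(\mathbb{R})} \le K \, \| F \|_{L^1_{od}(\mathbb{R}^2)}.$$ If moreover $u$ is real, that is, takes real values on real-valued Schwartz functions, then $C \in \mathbb{R}$. -/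

import Mathlib

open MeasureTheory Set
open scoped SchwartzMap LineDeriv ContDiff ENNReal

noncomputable section

/-! ### Off-diagonal Schwartz functions and off-diagonal distributions -/

/-- Differentiation in the first variable on `𝓢(ℝ²)`. -/
def partialX : 𝓢(ℝ × ℝ, ℂ) →L[ℂ] 𝓢(ℝ × ℝ, ℂ) :=
  LineDeriv.lineDerivOpCLM ℂ 𝓢(ℝ × ℝ, ℂ) ((1, 0) : ℝ × ℝ)

/-- Differentiation in the second variable on `𝓢(ℝ²)`. -/
def partialY : 𝓢(ℝ × ℝ, ℂ) →L[ℂ] 𝓢(ℝ × ℝ, ℂ) :=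
  LineDeriv.lineDerivOpCLM ℂ 𝓢(ℝ × ℝ, ℂ) ((0, 1) : ℝ × ℝ)

/-- The space of off-diagonal Schwartz functions on `ℝ²`: the antisymmetric Schwartz functions all
of whose partial derivatives vanish on the diagonal. As a submodule of `𝓢(ℝ²)` it carries the
subspace topology. -/
def offDiagSchwartz : Submodule ℂ 𝓢(ℝ × ℝ, ℂ) where
  carrier := {G | (∀ x y : ℝ, G (x, y) = -G (y, x)) ∧
    ∀ (a b : ℕ) (z : ℝ), (partialX ^ a) ((partialY ^ b) G) (z, z) = 0}
  add_mem' := by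
    rintro G H ⟨hG, hG'⟩ ⟨hH, hH'⟩
    refine ⟨fun x y => ?_, fun a b z => ?_⟩
    · simp only [add_apply, hG x y, hH x y]
      ring
    · simp only [map_add, add_apply, hG' a b z, hH' a b z, add_zero]
  zero_mem' := by
    refine ⟨fun x y => by simp, fun a b z => by simp⟩
  smul_mem' := by
    rintro c G ⟨hG, hG'⟩
    refine ⟨fun x y => ?_, fun a b z => ?_⟩
    · simp only [smul_apply, hG x y, smul_neg]
    · simp only [map_smul, smul_apply, hG' a b z, smul_zero]

/-- The space of off-diagonal tempered distributions: the continuous dual of the space of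
off-diagonal Schwartz functions. -/
abbrev OffDiagDistribution : Type := offDiagSchwartz →L[ℂ] ℂ

/-! ### The space `L¹_od` and its embedding in the off-diagonal distributions -/

/-- The measure `dx dy / |x - y|` on `ℝ²`. (The density is given the value `0` on the diagonal, a
null set.) -/
def offDiagMeasure : Measure (ℝ × ℝ) :=
  (volume : Measure (ℝ × ℝ)).withDensity fun p => ENNReal.ofReal (|p.1 - p.2|⁻¹)

/-- The space `L¹_od(ℝ²)` of (classes of) antisymmetric functions that are integrable with respect
to `dx dy / |x - y|`; its norm is that of `Lp ℂ 1 offDiagMeasure`. -/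
def L1od : Set (Lp ℂ 1 offDiagMeasure) :=
  {F | ∀ᵐ p ∂offDiagMeasure, F (p.2, p.1) = -F p}

theorem integrable_Lp_mul_schwartz (F : Lp ℂ 1 offDiagMeasure) (G : 𝓢(ℝ × ℝ, ℂ)) :
    Integrable (fun p => F p * G p) offDiagMeasure := by
  have hF : Integrable F offDiagMeasure := L1.integrable_coeFn F
  refine hF.mul_bdd (c := SchwartzMap.seminorm ℂ 0 0 G)
    G.continuous.aestronglyMeasurable (Filter.Eventually.of_forall fun p => ?_)
  exact SchwartzMap.norm_le_seminorm ℂ G p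

/-- The off-diagonal distribution `G ↦ ∬ F(x,y) G(x,y) dx dy / |x - y|` given by an integrable
function `F`. -/
def L1od.toDistribution (F : Lp ℂ 1 offDiagMeasure) : OffDiagDistribution :=
  (SchwartzMap.mkCLMtoNormedSpace (𝕜 := ℂ) (σ := RingHom.id ℂ)
    (fun G : 𝓢(ℝ × ℝ, ℂ) => ∫ p, F p * G p ∂offDiagMeasure)
    (fun G H => by
      simp only [add_apply, mul_add]
      exact integral_add (integrable_Lp_mul_schwartz F G) (integrable_Lp_mul_schwartz F H))
    (fun c G => by
      simp only [smul_apply, smul_eq_mul, RingHom.id_apply]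
      rw [← integral_const_mul]
      exact integral_congr_ae (Filter.Eventually.of_forall fun p => by ring))
    (by
      refine ⟨{(0, 0)}, ‖F‖, norm_nonneg _, fun G => ?_⟩
      have hF : Integrable F offDiagMeasure := L1.integrable_coeFn F
      rw [L1.norm_eq_integral_norm, ← integral_mul_const]
      refine norm_integral_le_of_norm_le (hF.norm.mul_const _)
        (Filter.Eventually.of_forall fun p => ?_)
      rw [norm_mul]
      refine mul_le_mul_of_nonneg_left ?_ (norm_nonneg _)
      simpa using SchwartzMap.norm_le_seminorm ℂ G p)).comp offDiagSchwartz.subtypeL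

theorem L1od.toDistribution_apply (F : Lp ℂ 1 offDiagMeasure) (G : offDiagSchwartz) :
    L1od.toDistribution F G = ∫ p, F p * (G : 𝓢(ℝ × ℝ, ℂ)) p ∂offDiagMeasure := rfl

/-! ### The fractional divergence -/

/-- The kernel `1 / (|x - y|^{1/2} |x - y|)`, as a function of `z = x - y`. -/
def halfKernel (z : ℝ) : ℝ := (|z| ^ (1 / 2 : ℝ))⁻¹ * |z|⁻¹

theorem halfKernel_nonneg (z : ℝ) : 0 ≤ halfKernel z := by
  unfold halfKernel; positivity

theorem measurable_halfKernel : Measurable halfKernel := by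
  unfold halfKernel; fun_prop

theorem integrable_min_mul_halfKernel :
    Integrable (fun z : ℝ => min |z| 1 * halfKernel z) := by
  have hpos : IntegrableOn (fun z : ℝ => min |z| 1 * halfKernel z) (Ioi 0) := by
    rw [← Ioc_union_Ioi_eq_Ioi (zero_le_one : (0 : ℝ) ≤ 1)]
    refine IntegrableOn.union ?_ ?_
    · have h : IntegrableOn (fun z : ℝ => z ^ (-(1 / 2) : ℝ)) (Ioc 0 1) := by
        have := intervalIntegral.intervalIntegrable_rpow' (a := 0) (b := 1)
          (r := -(1 / 2 : ℝ)) (by norm_num)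
        rwa [intervalIntegrable_iff_integrableOn_Ioc_of_le zero_le_one] at this
      refine h.congr_fun (fun z hz => ?_) measurableSet_Ioc
      have hz0 : 0 < z := hz.1
      simp only [halfKernel, abs_of_pos hz0, min_eq_left hz.2]
      rw [Real.rpow_neg hz0.le]
      field_simp
    · have h := integrableOn_Ioi_rpow_of_lt (a := -(3 / 2 : ℝ)) (c := 1) (by norm_num) one_pos
      refine h.congr_fun (fun z hz => ?_) measurableSet_Ioi
      have hz1 : 1 < z := hz
      have hz0 : 0 < z := one_pos.trans hz1
      simp only [halfKernel, abs_of_pos hz0, min_eq_right hz1.le]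
      rw [Real.rpow_neg hz0.le, show (3 / 2 : ℝ) = 1 / 2 + 1 by norm_num,
        Real.rpow_add hz0, Real.rpow_one, mul_inv, one_mul]
  have hneg : IntegrableOn (fun z : ℝ => min |z| 1 * halfKernel z) (Iio 0) := by
    have := hpos
    rw [show (0 : ℝ) = -0 by simp] at this
    have := this.comp_neg_Iio
    simpa [halfKernel] using this
  rw [← integrableOn_univ, ← Iio_union_Ici (a := (0 : ℝ))]
  exact hneg.union ((integrableOn_Ici_iff_integrableOn_Ioi (by simp)).2 hpos)

theorem norm_slice_le (k : ℕ) (K : 𝓢(ℝ × ℝ, ℂ)) (hK : ∀ x, K (x, 0) = 0) (x z : ℝ) :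
    |x| ^ k * ‖K (x, z)‖ ≤
      (SchwartzMap.seminorm ℂ k 1 K + SchwartzMap.seminorm ℂ k 0 K) * min |z| 1 := by
  have hx : ∀ t : ℝ, |x| ≤ ‖(x, t)‖ := fun t => by
    exact norm_fst_le (x, t)
  have h0 : |x| ^ k * ‖K (x, z)‖ ≤ SchwartzMap.seminorm ℂ k 0 K := by
    refine le_trans ?_ (SchwartzMap.norm_pow_mul_le_seminorm ℂ K k (x, z))
    gcongr
    exact hx z
  have h1 : |x| ^ k * ‖K (x, z)‖ ≤ SchwartzMap.seminorm ℂ k 1 K * |z| := by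
    have hd : ∀ t ∈ (univ : Set ℝ), HasDerivWithinAt (fun t : ℝ => ((|x| ^ k : ℝ) : ℂ) * K (x, t))
        (((|x| ^ k : ℝ) : ℂ) * fderiv ℝ K (x, t) (0, 1)) univ t := fun t _ => by
      have h2 : HasDerivAt (fun t : ℝ => (x, t)) ((0 : ℝ), (1 : ℝ)) t :=
        (hasDerivAt_const t x).prodMk (hasDerivAt_id t)
      exact (((K.hasFDerivAt (x, t)).comp_hasDerivAt t h2).const_mul _).hasDerivWithinAt
    have hb : ∀ t ∈ (univ : Set ℝ),
        ‖((|x| ^ k : ℝ) : ℂ) * fderiv ℝ K (x, t) (0, 1)‖ ≤ SchwartzMap.seminorm ℂ k 1 K := by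
      intro t _
      refine le_trans ?_ (SchwartzMap.le_seminorm ℂ k 1 K (x, t))
      rw [norm_mul, Complex.norm_real, Real.norm_of_nonneg (by positivity),
        norm_iteratedFDeriv_one]
      have := (fderiv ℝ K (x, t)).le_opNorm (0, 1)
      have h01 : ‖((0 : ℝ), (1 : ℝ))‖ = 1 := by simp
      rw [h01, mul_one] at this
      gcongr
      exact hx t
    have := convex_univ.norm_image_sub_le_of_norm_hasDerivWithin_le hd hb
      (mem_univ 0) (mem_univ z)
    simpa [hK, abs_of_nonneg (pow_nonneg (abs_nonneg x) k)] using this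
  have n1 : 0 ≤ SchwartzMap.seminorm ℂ k 1 K := apply_nonneg _ _
  have n0 : 0 ≤ SchwartzMap.seminorm ℂ k 0 K := apply_nonneg _ _
  rcases le_total |z| 1 with h | h
  · rw [min_eq_left h]
    nlinarith [abs_nonneg z]
  · rw [min_eq_right h]
    linarith

/-- The weighted integral over the second variable. -/
def sliceInt (K : 𝓢(ℝ × ℝ, ℂ)) (x : ℝ) : ℂ := ∫ z, K (x, z) * (halfKernel z : ℂ)

theorem norm_slice_mul_le (k : ℕ) (K : 𝓢(ℝ × ℝ, ℂ)) (hK : ∀ x, K (x, 0) = 0) (x z : ℝ) :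
    |x| ^ k * ‖K (x, z) * (halfKernel z : ℂ)‖ ≤
      (SchwartzMap.seminorm ℂ k 1 K + SchwartzMap.seminorm ℂ k 0 K) *
        (min |z| 1 * halfKernel z) := by
  rw [norm_mul, Complex.norm_real, Real.norm_of_nonneg (halfKernel_nonneg z), ← mul_assoc,
    ← mul_assoc]
  exact mul_le_mul_of_nonneg_right (norm_slice_le k K hK x z) (halfKernel_nonneg z)

theorem aestronglyMeasurable_slice (K : 𝓢(ℝ × ℝ, ℂ)) (x : ℝ) :
    AEStronglyMeasurable (fun z => K (x, z) * (halfKernel z : ℂ)) volume := by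
  refine AEStronglyMeasurable.mul ?_ ?_
  · exact (K.continuous.comp (by fun_prop : Continuous fun z : ℝ => (x, z))).aestronglyMeasurable
  · exact (Complex.measurable_ofReal.comp measurable_halfKernel).aestronglyMeasurable

theorem integrable_slice (K : 𝓢(ℝ × ℝ, ℂ)) (hK : ∀ x, K (x, 0) = 0) (x : ℝ) :
    Integrable (fun z => K (x, z) * (halfKernel z : ℂ)) := by
  refine (integrable_min_mul_halfKernel.const_mul
    (SchwartzMap.seminorm ℂ 0 1 K + SchwartzMap.seminorm ℂ 0 0 K)).mono'
    (aestronglyMeasurable_slice K x) (Filter.Eventually.of_forall fun z => ?_)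
  simpa using norm_slice_mul_le 0 K hK x z

theorem pow_mul_norm_sliceInt_le (k : ℕ) (K : 𝓢(ℝ × ℝ, ℂ)) (hK : ∀ x, K (x, 0) = 0) (x : ℝ) :
    |x| ^ k * ‖sliceInt K x‖ ≤
      (SchwartzMap.seminorm ℂ k 1 K + SchwartzMap.seminorm ℂ k 0 K) *
        ∫ z, min |z| 1 * halfKernel z := by
  have h : |x| ^ k * ‖sliceInt K x‖ =
      ‖∫ z, ((|x| ^ k : ℝ) : ℂ) * (K (x, z) * (halfKernel z : ℂ))‖ := by
    rw [integral_const_mul, norm_mul, Complex.norm_real, Real.norm_of_nonneg (by positivity)]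
    rfl
  rw [h, ← integral_const_mul]
  refine norm_integral_le_of_norm_le (integrable_min_mul_halfKernel.const_mul _)
    (Filter.Eventually.of_forall fun z => ?_)
  rw [norm_mul, Complex.norm_real, Real.norm_of_nonneg (by positivity)]
  exact norm_slice_mul_le k K hK x z

theorem hasDerivAt_slice (K : 𝓢(ℝ × ℝ, ℂ)) (x z : ℝ) :
    HasDerivAt (fun x => K (x, z)) (partialX K (x, z)) x := by
  have h2 : HasDerivAt (fun t : ℝ => (t, z)) ((1 : ℝ), (0 : ℝ)) x :=
    (hasDerivAt_id x).prodMk (hasDerivAt_const x z)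
  exact (K.hasFDerivAt (x, z)).comp_hasDerivAt x h2

theorem partialX_vanish (K : 𝓢(ℝ × ℝ, ℂ)) (hK : ∀ x, K (x, 0) = 0) (x : ℝ) :
    partialX K (x, 0) = 0 := by
  have h := hasDerivAt_slice K x 0
  simp only [hK] at h
  exact h.unique (hasDerivAt_const x 0)

theorem partialX_pow_vanish (K : 𝓢(ℝ × ℝ, ℂ)) (hK : ∀ x, K (x, 0) = 0) (n : ℕ) :
    ∀ x, (partialX ^ n) K (x, 0) = 0 := by
  induction n with
  | zero => simpa using hK
  | succ n ih =>
    rw [pow_succ']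
    exact partialX_vanish _ ih

theorem hasDerivAt_sliceInt (K : 𝓢(ℝ × ℝ, ℂ)) (hK : ∀ x, K (x, 0) = 0) (x : ℝ) :
    HasDerivAt (sliceInt K) (sliceInt (partialX K) x) x := by
  refine (hasDerivAt_integral_of_dominated_loc_of_deriv_le (s := univ)
    (F := fun x z => K (x, z) * (halfKernel z : ℂ))
    (F' := fun x z => partialX K (x, z) * (halfKernel z : ℂ))
    (bound := fun z => (SchwartzMap.seminorm ℂ 0 1 (partialX K) +
      SchwartzMap.seminorm ℂ 0 0 (partialX K)) * (min |z| 1 * halfKernel z))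
    Filter.univ_mem (Filter.Eventually.of_forall fun x => aestronglyMeasurable_slice K x)
    (integrable_slice K hK x) (aestronglyMeasurable_slice _ x)
    (Filter.Eventually.of_forall fun z x _ => ?_)
    (integrable_min_mul_halfKernel.const_mul _)
    (Filter.Eventually.of_forall fun z x _ => (hasDerivAt_slice K x z).mul_const _)).2
  simpa using norm_slice_mul_le 0 (partialX K) (partialX_vanish K hK) x z

theorem iteratedDeriv_sliceInt (K : 𝓢(ℝ × ℝ, ℂ)) (hK : ∀ x, K (x, 0) = 0) (n : ℕ) :
    iteratedDeriv n (sliceInt K) = sliceInt ((partialX ^ n) K) := by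
  induction n with
  | zero => simp
  | succ n ih =>
    rw [iteratedDeriv_succ, ih, pow_succ']
    funext x
    exact (hasDerivAt_sliceInt _ (partialX_pow_vanish K hK n) x).deriv

theorem contDiff_sliceInt (K : 𝓢(ℝ × ℝ, ℂ)) (hK : ∀ x, K (x, 0) = 0) :
    ContDiff ℝ ∞ (sliceInt K) := by
  refine contDiff_of_differentiable_iteratedDeriv fun n _ => ?_
  rw [iteratedDeriv_sliceInt K hK n]
  exact fun x => (hasDerivAt_sliceInt _ (partialX_pow_vanish K hK n) x).differentiableAt

/-- The linear change of variables `(x, z) ↦ (x, x - z)`. -/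
def shearEquiv : (ℝ × ℝ) ≃L[ℝ] (ℝ × ℝ) :=
  LinearEquiv.toContinuousLinearEquiv
    { toFun := fun p => (p.1, p.1 - p.2)
      invFun := fun p => (p.1, p.1 - p.2)
      map_add' := fun p q => by ext <;> simp <;> ring
      map_smul' := fun c p => by ext <;> simp <;> ring
      left_inv := fun p => by ext <;> simp
      right_inv := fun p => by ext <;> simp }

/-- The map taking `G` to the function `(x, z) ↦ G(x, x - z) - G(x - z, x)`. -/
def antisymmSlice : 𝓢(ℝ × ℝ, ℂ) →L[ℂ] 𝓢(ℝ × ℝ, ℂ) :=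
  SchwartzMap.compCLMOfContinuousLinearEquiv ℂ shearEquiv -
    SchwartzMap.compCLMOfContinuousLinearEquiv ℂ
      (shearEquiv.trans (ContinuousLinearEquiv.prodComm ℝ ℝ ℝ))

theorem antisymmSlice_apply (G : 𝓢(ℝ × ℝ, ℂ)) (x z : ℝ) :
    antisymmSlice G (x, z) = G (x, x - z) - G (x - z, x) := rfl

theorem antisymmSlice_vanish (G : 𝓢(ℝ × ℝ, ℂ)) (x : ℝ) : antisymmSlice G (x, 0) = 0 := by
  simp [antisymmSlice_apply]

/-- The `1/2`-divergence as a function,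
`x ↦ ∫ (G(x,y) - G(y,x)) / |x - y|^{1/2} dy / |x - y|`. -/
def fracDivFun (G : 𝓢(ℝ × ℝ, ℂ)) (x : ℝ) : ℂ :=
  ∫ y, (G (x, y) - G (y, x)) / ((|x - y| ^ (1 / 2 : ℝ) : ℝ) : ℂ) / ((|x - y| : ℝ) : ℂ)

theorem fracDivFun_eq_sliceInt (G : 𝓢(ℝ × ℝ, ℂ)) : fracDivFun G = sliceInt (antisymmSlice G) := by
  funext x
  unfold fracDivFun sliceInt
  rw [← integral_sub_left_eq_self _ volume x]
  refine integral_congr_ae (Filter.Eventually.of_forall fun z => ?_)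
  simp only [antisymmSlice_apply, halfKernel, sub_sub_cancel]
  push_cast
  rw [div_eq_mul_inv, div_eq_mul_inv, mul_assoc]

/-- The `1/2`-divergence as a continuous linear map on Schwartz functions. -/
def fracDiv : 𝓢(ℝ × ℝ, ℂ) →L[ℂ] 𝓢(ℝ, ℂ) :=
  SchwartzMap.mkCLM (𝕜 := ℂ) (σ := RingHom.id ℂ) fracDivFun
    (fun G H x => by
      simp only [fracDivFun_eq_sliceInt, sliceInt, map_add, add_apply, add_mul]
      exact integral_add (integrable_slice _ (antisymmSlice_vanish G) x)
        (integrable_slice _ (antisymmSlice_vanish H) x))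
    (fun c G x => by
      simp only [fracDivFun_eq_sliceInt, sliceInt, map_smul, smul_apply, smul_eq_mul,
        mul_assoc, RingHom.id_apply]
      exact integral_const_mul _ _)
    (fun G => by
      rw [fracDivFun_eq_sliceInt]
      exact contDiff_sliceInt _ (antisymmSlice_vanish G))
    (by
      rintro ⟨k, n⟩
      let I : ℝ := ∫ z, min |z| 1 * halfKernel z
      have hI : 0 ≤ I := integral_nonneg fun z =>
        mul_nonneg (le_min (abs_nonneg z) zero_le_one) (halfKernel_nonneg z)
      let L : 𝓢(ℝ × ℝ, ℂ) →L[ℂ] 𝓢(ℝ × ℝ, ℂ) := (partialX ^ n) ∘L antisymmSlice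
      let q : Seminorm ℂ 𝓢(ℝ × ℝ, ℂ) :=
        (SchwartzMap.seminorm ℂ k 1 + SchwartzMap.seminorm ℂ k 0).comp L.toLinearMap
      have hq : Continuous q := by
        have h1 := (schwartz_withSeminorms ℂ (ℝ × ℝ) ℂ).continuous_seminorm (k, 1)
        have h0 := (schwartz_withSeminorms ℂ (ℝ × ℝ) ℂ).continuous_seminorm (k, 0)
        exact (h1.add h0).comp L.continuous
      obtain ⟨s, C, -, hC⟩ := Seminorm.bound_of_continuous
        (schwartz_withSeminorms ℂ (ℝ × ℝ) ℂ) q hq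
      refine ⟨s, C * I, mul_nonneg C.2 hI, fun G x => ?_⟩
      have h := pow_mul_norm_sliceInt_le k ((partialX ^ n) (antisymmSlice G))
        (partialX_pow_vanish _ (antisymmSlice_vanish G) n) x
      rw [norm_iteratedFDeriv_eq_norm_iteratedDeriv, fracDivFun_eq_sliceInt,
        iteratedDeriv_sliceInt _ (antisymmSlice_vanish G), Real.norm_eq_abs]
      refine h.trans ?_
      have hG : q G ≤ C * (s.sup (schwartzSeminormFamily ℂ (ℝ × ℝ) ℂ)) G := hC G
      calc q G * I ≤ (C * (s.sup (schwartzSeminormFamily ℂ (ℝ × ℝ) ℂ)) G) * I :=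
            mul_le_mul_of_nonneg_right hG hI
        _ = C * I * (s.sup (schwartzSeminormFamily ℂ (ℝ × ℝ) ℂ)) G := by ring)

theorem fracDiv_apply (G : 𝓢(ℝ × ℝ, ℂ)) (x : ℝ) :
    fracDiv G x =
      ∫ y, (G (x, y) - G (y, x)) / ((|x - y| ^ (1 / 2 : ℝ) : ℝ) : ℂ) / ((|x - y| : ℝ) : ℂ) :=
  rfl

theorem fracDiv_apply_offDiag (G : offDiagSchwartz) (x : ℝ) :
    fracDiv G x = ∫ y, 2 * (G : 𝓢(ℝ × ℝ, ℂ)) (x, y) / ((|x - y| ^ (1 / 2 : ℝ) : ℝ) : ℂ) /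
      ((|x - y| : ℝ) : ℂ) := by
  rw [fracDiv_apply]
  refine integral_congr_ae (Filter.Eventually.of_forall fun y => ?_)
  simp only [G.2.1 y x, sub_neg_eq_add, two_mul]

/-! ### The distributional fractional gradient -/

/-- The distributional `1/2`-gradient `d_{1/2} u` of a tempered distribution `u`, the off-diagonal
distribution with `⟨d_{1/2} u, G⟩ = ⟨u, div_{1/2} G⟩`. -/
def fracGrad (u : 𝓢'(ℝ, ℂ)) : OffDiagDistribution where
  toFun G := u (fracDiv G)
  map_add' G H := by simp
  map_smul' c G := by simp
  cont := u.continuous.comp (fracDiv.continuous.comp continuous_subtype_val)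

/-- The tempered distribution given by a constant function. -/
def constDistribution (C : ℂ) : 𝓢'(ℝ, ℂ) :=
  C • (volume : Measure ℝ).toTemperedDistribution

/-- A tempered distribution is real if it takes real values on real-valued test functions. -/
def IsRealDistribution (u : 𝓢'(ℝ, ℂ)) : Prop :=
  ∀ ψ : 𝓢(ℝ, ℂ), (∀ x, (ψ x).im = 0) → (u ψ).im = 0

end

/-! By duality it suffices to prove `‖u φ‖ ≤ A² ‖φ‖₂ ‖F‖` for compactly supported test functions `φ`
of mean zero. Write `φ_r` for the smearing of `φ` by a normalised bump of scale `r`. The weight `|x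
- y|^{3/2} / 2` times an antisymmetrised correlation of `φ` with the bumps of scales `r` and `2r`
cancels the kernel of the divergence. This product is an off-diagonal test function `G_r` with
divergence `φ_r - φ_{2r}` (`fracDivFun_gapFun`, `exists_offDiag_scale`).

By Cauchy–Schwarz the correlation is `O(r^{-3/2}) ‖φ‖₂`, so `G_r` is bounded by `A² ‖φ‖₂` at every
scale. Moreover `G_r` lives on a band `|x - y| ∼ r`, and the bands of distinct dyadic scales are
disjoint. A telescoping sum of the `G_{2^j r}` therefore has the same sup bound as one term, and
pairing with `F` bounds `u φ_r - u φ_{2^n r}` uniformly in `n` and `r` (`norm_bumpSmear_sub_le`).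

As `r → 0`, `φ_r → φ` in the Schwartz space. At large scales, mean zero gives `φ = ψ'` with `ψ`
compactly supported; integrating by parts moves the derivative onto the bump, and the same
construction shows that `u φ_R` is `O(1/R)` (`norm_bumpSmear_deriv_le`). The two limits give the
estimate (`norm_apply_le_of_integral_eq_zero`).

Hahn–Banach and Riesz then produce `v ∈ L²` agreeing with `u` on mean-zero test functions, so `u -
v` is a constant `C`. Testing against wide real cutoffs shows that `C` is real when `u` is. -/

noncomputable section

/-! ### Correlations of a function with two bumps -/

/-- The correlation `(x, y) ↦ ∫ α(t - x) β(t - y) φ(t) dt`. -/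
def corr (φ : ℝ → ℂ) (α β : ℝ → ℝ) (x y : ℝ) : ℂ := ∫ t, (α (t - x) * β (t - y)) • φ t

/-- The correlation `x ↦ ∫ α(t - x) φ(t) dt`. -/
def smear (φ : ℝ → ℂ) (α : ℝ → ℝ) (x : ℝ) : ℂ := ∫ t, α (t - x) • φ t

theorem smear_eq_corr (φ : ℝ → ℂ) (α : ℝ → ℝ) (x : ℝ) :
    smear φ α x = corr φ α (fun _ => 1) x 0 := by
  simp [smear, corr]

variable {φ : ℝ → ℂ} {α β : ℝ → ℝ} {p q p' q' : ℝ}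

/-- The substitution `s = x - t` makes this a convolution of `φ` with a smooth kernel depending on
the parameter `(x, y)`; the support of `α` alone keeps the kernel in a fixed compact set. -/
theorem contDiff_corr (hφ : Continuous φ) (hα : ContDiff ℝ ∞ α)
    (hαs : ∀ x, x ∉ Icc p q → α x = 0) (hβ : ContDiff ℝ ∞ β) :
    ContDiff ℝ ∞ (fun w : ℝ × ℝ => corr φ α β w.1 w.2) := by
  have h := contDiffOn_convolution_right_with_param_comp (𝕜 := ℝ) (μ := (volume : Measure ℝ))
    (n := ⊤) (ContinuousLinearMap.lsmul ℝ ℝ : ℝ →L[ℝ] ℂ →L[ℝ] ℂ).flip (s := univ)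
    (v := fun w : ℝ × ℝ => w.1) contDiff_fst.contDiffOn (f := φ)
    (g := fun (w : ℝ × ℝ) s => α (-s) * β (-s + (w.1 - w.2))) (k := Icc (-q) (-p))
    isOpen_univ isCompact_Icc ?_ hφ.locallyIntegrable ?_
  · rw [contDiffOn_univ] at h
    convert h using 2 with w
    simp only [corr, convolution, ContinuousLinearMap.flip_apply, ContinuousLinearMap.lsmul_apply]
    congr 1 with t
    congr 2 <;> ring_nf
  · intro w s _ hs
    rw [hαs, zero_mul]
    contrapose! hs
    exact ⟨by linarith [hs.2], by linarith [hs.1]⟩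
  · apply ContDiff.contDiffOn
    apply ContDiff.mul
    · exact hα.comp (by fun_prop)
    · exact hβ.comp (by fun_prop)

theorem contDiff_smear (hφ : Continuous φ) (hα : ContDiff ℝ ∞ α)
    (hαs : ∀ x, x ∉ Icc p q → α x = 0) : ContDiff ℝ ∞ (smear φ α) := by
  have h := (contDiff_corr hφ hα hαs (contDiff_const (c := (1 : ℝ)))).comp
    (contDiff_id.prodMk (contDiff_const (c := (0 : ℝ))))
  convert h using 1
  funext x
  exact smear_eq_corr φ α x

/-- Both bumps can be nonzero at `t` only if `x - y = (t - y) - (t - x)` lies in the difference of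
their supports, whatever `φ` is. This localises the test functions in bands parallel to the
diagonal. -/
theorem corr_eq_zero_of_sub_notMem (hαs : ∀ x, x ∉ Icc p q → α x = 0)
    (hβs : ∀ x, x ∉ Icc p' q' → β x = 0) {x y : ℝ} (h : x - y ∉ Icc (p' - q) (q' - p)) :
    corr φ α β x y = 0 := by
  refine integral_eq_zero_of_ae (Filter.Eventually.of_forall fun t => ?_)
  by_cases h1 : t - x ∈ Icc p q
  · simp only [Pi.zero_apply]
    rw [hβs, mul_zero, zero_smul]
    contrapose! h
    exact ⟨by linarith [h1.2, h.1], by linarith [h1.1, h.2]⟩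
  · simp [hαs _ h1]

theorem smear_eq_zero {R : ℝ} (hφs : ∀ x, x ∉ Icc (-R) R → φ x = 0)
    (hαs : ∀ x, x ∉ Icc p q → α x = 0) {x : ℝ} (h : x ∉ Icc (-R - q) (R - p)) :
    smear φ α x = 0 := by
  refine integral_eq_zero_of_ae (Filter.Eventually.of_forall fun t => ?_)
  by_cases h1 : t - x ∈ Icc p q
  · simp only [Pi.zero_apply]
    rw [hφs, smul_zero]
    contrapose! h
    exact ⟨by linarith [h1.2, h.1], by linarith [h1.1, h.2]⟩
  · simp [hαs _ h1]

theorem corr_eq_zero {R : ℝ} (hφs : ∀ x, x ∉ Icc (-R) R → φ x = 0)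
    (hαs : ∀ x, x ∉ Icc p q → α x = 0) (hβs : ∀ x, x ∉ Icc p' q' → β x = 0) {x y : ℝ}
    (h : (x, y) ∉ Icc (-R - q) (R - p) ×ˢ Icc (-R - q') (R - p')) :
    corr φ α β x y = 0 := by
  refine integral_eq_zero_of_ae (Filter.Eventually.of_forall fun t => ?_)
  by_cases h1 : t - x ∈ Icc p q
  · by_cases h2 : t - y ∈ Icc p' q'
    · simp only [Pi.zero_apply]
      rw [hφs, smul_zero]
      contrapose! h
      exact ⟨⟨by linarith [h1.2, h.1], by linarith [h1.1, h.2]⟩,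
        ⟨by linarith [h2.2, h.1], by linarith [h2.1, h.2]⟩⟩
    · simp [hβs _ h2]
  · simp [hαs _ h1]

theorem integral_corr_right {R : ℝ} (hφ : Continuous φ) (hφs : ∀ x, x ∉ Icc (-R) R → φ x = 0)
    (hα : Continuous α) (hβ : Continuous β) (hβs : ∀ x, x ∉ Icc p' q' → β x = 0) (x : ℝ) :
    ∫ y, corr φ α β x y = ((∫ s, β s : ℝ) : ℂ) * smear φ α x := by
  unfold corr smear
  rw [integral_integral_swap_of_hasCompactSupport (f := fun y t => (α (t - x) * β (t - y)) • φ t)]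
  · rw [← integral_const_mul]
    congr 1 with t
    rw [integral_smul_const, integral_const_mul, integral_sub_left_eq_self (fun s => β s)]
    simp only [Complex.real_smul]
    push_cast
    ring
  · simp only [Function.uncurry_def]
    fun_prop
  · refine HasCompactSupport.intro (K := Icc (-R - q') (R - p') ×ˢ Icc (-R) R)
      (isCompact_Icc.prod isCompact_Icc) ?_
    rintro ⟨y, t⟩ h
    simp only [Function.uncurry_apply_pair]
    by_cases h1 : t ∈ Icc (-R) R
    · rw [hβs, mul_zero, zero_smul]
      contrapose! h
      exact ⟨⟨by linarith [h.2, h1.1], by linarith [h.1, h1.2]⟩, h1⟩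
    · rw [hφs t h1, smul_zero]

theorem corr_swap (φ : ℝ → ℂ) (α β : ℝ → ℝ) (x y : ℝ) : corr φ α β x y = corr φ β α y x := by
  simp only [corr, mul_comm]

/-! ### Off-diagonal test functions built from correlations -/

/-- The antisymmetric function whose `1/2`-divergence is a difference of two smearings. -/
def gapFun (φ : ℝ → ℂ) (α β : ℝ → ℝ) (w : ℝ × ℝ) : ℂ :=
  (1 / 2 * |w.1 - w.2| ^ (3 / 2 : ℝ)) • (corr φ α β w.1 w.2 - corr φ α β w.2 w.1)

theorem gapFun_eq_zero_of_abs_lt (hαs : ∀ x, x ∉ Icc p q → α x = 0)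
    (hβs : ∀ x, x ∉ Icc p' q' → β x = 0) {w : ℝ × ℝ} (h : |w.1 - w.2| < p' - q) :
    gapFun φ α β w = 0 := by
  have h' := abs_lt.1 h
  rw [gapFun, corr_eq_zero_of_sub_notMem hαs hβs (fun h1 => by linarith [h1.1, h'.2]),
    corr_eq_zero_of_sub_notMem hαs hβs (fun h1 => by linarith [h1.1, h'.1]), sub_zero, smul_zero]

/-- The weight `|x - y|^{3/2}` is singular only on the diagonal, where the gap `q < p'` makes the
function vanish in a whole neighbourhood. -/
theorem contDiff_gapFun (hφ : Continuous φ) (hα : ContDiff ℝ ∞ α)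
    (hαs : ∀ x, x ∉ Icc p q → α x = 0) (hβ : ContDiff ℝ ∞ β)
    (hβs : ∀ x, x ∉ Icc p' q' → β x = 0) (hgap : q < p') :
    ContDiff ℝ ∞ (gapFun φ α β) := by
  rw [contDiff_iff_contDiffAt]
  intro w
  have hc := contDiff_corr hφ hα hαs hβ
  have hc' := hc.comp (contDiff_snd.prodMk contDiff_fst : ContDiff ℝ ∞ fun w : ℝ × ℝ => (w.2, w.1))
  by_cases h : w.1 - w.2 = 0
  · have : gapFun φ α β =ᶠ[nhds w] fun _ => 0 := by
      have ho : IsOpen {w : ℝ × ℝ | |w.1 - w.2| < p' - q} :=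
        isOpen_lt (by fun_prop) continuous_const
      filter_upwards [ho.mem_nhds (show |w.1 - w.2| < p' - q by rw [h, abs_zero]; linarith)]
        with v hv
      exact gapFun_eq_zero_of_abs_lt hαs hβs hv
    exact contDiffAt_const.congr_of_eventuallyEq this
  · refine ContDiffAt.smul (𝕜' := ℝ)
      (f := fun w : ℝ × ℝ => (1 / 2 * |w.1 - w.2| ^ (3 / 2 : ℝ) : ℝ)) ?_ (hc.sub hc').contDiffAt
    refine contDiffAt_const.mul (ContDiffAt.rpow_const_of_ne ?_ (abs_ne_zero.2 h))
    exact ContDiffAt.comp (g := fun t : ℝ => |t|) w (contDiffAt_abs h)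
      (contDiff_fst.sub contDiff_snd).contDiffAt

theorem hasCompactSupport_gapFun {R : ℝ} (hφs : ∀ x, x ∉ Icc (-R) R → φ x = 0)
    (hαs : ∀ x, x ∉ Icc p q → α x = 0) (hβs : ∀ x, x ∉ Icc p' q' → β x = 0) :
    HasCompactSupport (gapFun φ α β) := by
  have hK := (isCompact_Icc (a := -R - q) (b := R - p)).prod
    (isCompact_Icc (a := -R - q') (b := R - p'))
  refine HasCompactSupport.intro (hK.union (hK.image continuous_swap)) fun w hw => ?_
  rw [gapFun, corr_eq_zero hφs hαs hβs, corr_eq_zero hφs hαs hβs, sub_zero, smul_zero]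
  · exact fun h => hw (Or.inr ⟨(w.2, w.1), h, rfl⟩)
  · exact fun h => hw (Or.inl h)

/-- Differentiation does not enlarge the topological support, which here misses the diagonal. -/
theorem mem_offDiagSchwartz_of_eq_zero {G : 𝓢(ℝ × ℝ, ℂ)} (hG : ∀ x y, G (x, y) = -G (y, x))
    {ε : ℝ} (hε : 0 < ε) (h : ∀ w : ℝ × ℝ, |w.1 - w.2| < ε → G w = 0) :
    G ∈ offDiagSchwartz := by
  have ho : IsOpen {w : ℝ × ℝ | |w.1 - w.2| < ε} := isOpen_lt (by fun_prop) continuous_const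
  have hX : ∀ a (H : 𝓢(ℝ × ℝ, ℂ)), tsupport ((partialX ^ a) H) ⊆ tsupport H := by
    intro a
    induction a with
    | zero => intro H; simp
    | succ a ih =>
      intro H
      rw [pow_succ]
      exact (ih _).trans (SchwartzMap.tsupport_lineDerivOp_subset _ H)
  have hY : ∀ a (H : 𝓢(ℝ × ℝ, ℂ)), tsupport ((partialY ^ a) H) ⊆ tsupport H := by
    intro a
    induction a with
    | zero => intro H; simp
    | succ a ih =>
      intro H
      rw [pow_succ]
      exact (ih _).trans (SchwartzMap.tsupport_lineDerivOp_subset _ H)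
  refine ⟨hG, fun a b z => image_eq_zero_of_notMem_tsupport fun hz => ?_⟩
  have hz' := hY b G (hX a _ hz)
  have hsub : tsupport G ⊆ {w : ℝ × ℝ | |w.1 - w.2| < ε}ᶜ :=
    closure_minimal (fun w hw hw' => hw (h w hw')) ho.isClosed_compl
  exact hsub hz' (by simpa using hε)

/-- Since `3/2 = 1/2 + 1`, the weight cancels the kernel exactly. What remains is the `y`-integral
of two correlations, each of which factors by Fubini. -/
theorem fracDivFun_gapFun {R : ℝ} (hφ : Continuous φ) (hφs : ∀ x, x ∉ Icc (-R) R → φ x = 0)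
    (hα : ContDiff ℝ ∞ α) (hαs : ∀ x, x ∉ Icc p q → α x = 0) (hβ : ContDiff ℝ ∞ β)
    (hβs : ∀ x, x ∉ Icc p' q' → β x = 0) (hgap : q < p') (x : ℝ) :
    ∫ y, 2 * gapFun φ α β (x, y) / ((|x - y| ^ (1 / 2 : ℝ) : ℝ) : ℂ) / ((|x - y| : ℝ) : ℂ) =
      ((∫ s, β s : ℝ) : ℂ) * smear φ α x - ((∫ s, α s : ℝ) : ℂ) * smear φ β x := by
  have hi : ∀ {α β : ℝ → ℝ} {p q p' q' : ℝ}, ContDiff ℝ ∞ α → (∀ x, x ∉ Icc p q → α x = 0) →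
      ContDiff ℝ ∞ β → (∀ x, x ∉ Icc p' q' → β x = 0) →
      Integrable (fun y => corr φ α β x y) := by
    intro α β p q p' q' hα hαs hβ hβs
    refine Continuous.integrable_of_hasCompactSupport ?_ ?_
    · exact (contDiff_corr hφ hα hαs hβ).continuous.comp (by fun_prop : Continuous fun y => (x, y))
    · refine HasCompactSupport.intro (isCompact_Icc (a := -R - q') (b := R - p')) fun y hy => ?_
      exact corr_eq_zero hφs hαs hβs fun h => hy h.2
  rw [← integral_corr_right hφ hφs hα.continuous hβ.continuous hβs,
    ← integral_corr_right hφ hφs hβ.continuous hα.continuous hαs,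
    ← integral_sub (hi hα hαs hβ hβs) (hi hβ hβs hα hαs)]
  congr 1 with y
  rw [← corr_swap φ α β y x]
  by_cases h : x - y = 0
  -- On the diagonal the quotient is `0` by the convention for division by zero, and the gap makes
  -- both correlations vanish as well.
  · rw [corr_eq_zero_of_sub_notMem hαs hβs (fun h1 => by linarith [h1.1]),
      corr_eq_zero_of_sub_notMem hαs hβs (fun h1 => by linarith [h1.1])]
    simp [h]
  · have hpos : 0 < |x - y| := abs_pos.2 h
    have e : |x - y| ^ (3 / 2 : ℝ) = |x - y| ^ (1 / 2 : ℝ) * |x - y| := by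
      rw [show (3 / 2 : ℝ) = 1 / 2 + 1 by norm_num, Real.rpow_add hpos, Real.rpow_one]
    have h1 : ((|x - y| ^ (1 / 2 : ℝ) : ℝ) : ℂ) ≠ 0 := by
      exact_mod_cast (Real.rpow_pos_of_pos hpos _).ne'
    have h2 : ((|x - y| : ℝ) : ℂ) ≠ 0 := by exact_mod_cast hpos.ne'
    simp only [gapFun, e, Complex.real_smul]
    rw [div_div, div_eq_iff (mul_ne_zero h1 h2)]
    push_cast
    ring

theorem exists_offDiag_gapFun {R : ℝ} (hφ : Continuous φ) (hφs : ∀ x, x ∉ Icc (-R) R → φ x = 0)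
    (hα : ContDiff ℝ ∞ α) (hαs : ∀ x, x ∉ Icc p q → α x = 0) (hβ : ContDiff ℝ ∞ β)
    (hβs : ∀ x, x ∉ Icc p' q' → β x = 0) (hgap : q < p') :
    ∃ G : offDiagSchwartz, (∀ w, (G : 𝓢(ℝ × ℝ, ℂ)) w = gapFun φ α β w) ∧
      ∀ x, fracDiv G x =
        ((∫ s, β s : ℝ) : ℂ) * smear φ α x - ((∫ s, α s : ℝ) : ℂ) * smear φ β x := by
  refine ⟨⟨(hasCompactSupport_gapFun hφs hαs hβs).toSchwartzMap
    (contDiff_gapFun hφ hα hαs hβ hβs hgap),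
    mem_offDiagSchwartz_of_eq_zero (fun x y => ?_) (sub_pos.2 hgap) fun w hw => ?_⟩,
    fun w => rfl, fun x => ?_⟩
  · simp only [HasCompactSupport.toSchwartzMap_toFun, gapFun]
    rw [abs_sub_comm, ← smul_neg, neg_sub]
  · exact gapFun_eq_zero_of_abs_lt hαs hβs hw
  · rw [fracDiv_apply_offDiag]
    exact fracDivFun_gapFun hφ hφs hα hαs hβ hβs hgap x

end

noncomputable section

variable {α β : ℝ → ℝ} {p q p' q' : ℝ}

/-! ### Uniform bounds -/

/-- Cauchy–Schwarz against `A` times the indicator of `[c, d]`. -/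
theorem norm_integral_smul_le_norm_toLp (φ : 𝓢(ℝ, ℂ)) {h : ℝ → ℝ} {A c d : ℝ}
    (hA : ∀ x, |h x| ≤ A) (hs : ∀ x, x ∉ Icc c d → h x = 0) :
    ‖∫ t, h t • φ t‖ ≤ A * √(d - c) * ‖φ.toLp 2‖ := by
  have hA0 : 0 ≤ A := (abs_nonneg _).trans (hA 0)
  set g : ℝ → ℝ := (Icc c d).indicator fun _ => A with hg
  have hgL : ∀ s, MemLp g s volume := fun s =>
    memLp_indicator_const s measurableSet_Icc A (Or.inr (by simp))
  have hφL : ∀ s, MemLp (fun t => ‖φ t‖) s volume := fun s => (φ.memLp s).norm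
  have hint : Integrable (fun t => ‖g t‖ * ‖‖φ t‖‖) :=
    ((hgL 2).norm.integrable_mul (hφL 2).norm)
  have h1 : ‖∫ t, h t • φ t‖ ≤ ∫ t, ‖g t‖ * ‖‖φ t‖‖ := by
    refine norm_integral_le_of_norm_le hint (Filter.Eventually.of_forall fun t => ?_)
    rw [norm_smul, norm_norm]
    by_cases ht : t ∈ Icc c d
    · rw [hg, indicator_of_mem ht, Real.norm_of_nonneg hA0]
      exact mul_le_mul_of_nonneg_right (hA t) (norm_nonneg _)
    · rw [hs t ht, norm_zero, zero_mul]
      positivity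
  have h2 := integral_mul_norm_le_Lp_mul_Lq (μ := (volume : Measure ℝ)) (f := g)
    (g := fun t => ‖φ t‖) Real.HolderConjugate.two_two (hgL _) (hφL _)
  refine h1.trans (h2.trans_eq ?_)
  -- The maximum covers `d < c`, where the interval is empty and `√(d - c) = 0`.
  have e1 : ∫ t, ‖g t‖ ^ (2 : ℝ) = max (d - c) 0 * A ^ 2 := by
    have : (fun t => ‖g t‖ ^ (2 : ℝ)) = (Icc c d).indicator fun _ => A ^ 2 := by
      funext t
      by_cases ht : t ∈ Icc c d <;> simp [hg, ht]
    rw [this, integral_indicator measurableSet_Icc, setIntegral_const]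
    simp [Measure.real, ENNReal.toReal_ofReal']
  rw [e1, SchwartzMap.norm_toLp' (by norm_num) (by norm_num)]
  simp only [norm_norm, ENNReal.toReal_ofNat, one_div]
  congr 1
  rw [← one_div, ← Real.sqrt_eq_rpow, Real.sqrt_mul (le_max_right _ _), Real.sqrt_sq hA0, mul_comm]
  congr 1
  rcases le_total (d - c) 0 with h | h
  · rw [max_eq_right h, Real.sqrt_eq_zero_of_nonpos h, Real.sqrt_zero]
  · rw [max_eq_left h]

theorem norm_corr_le (φ : 𝓢(ℝ, ℂ)) {A B : ℝ} (hA : ∀ x, |α x| ≤ A) (hB : ∀ x, |β x| ≤ B)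
    (hαs : ∀ x, x ∉ Icc p q → α x = 0) (x y : ℝ) :
    ‖corr φ α β x y‖ ≤ A * B * √(q - p) * ‖φ.toLp 2‖ := by
  have h := norm_integral_smul_le_norm_toLp φ (h := fun t => α (t - x) * β (t - y))
    (A := A * B) (c := x + p) (d := x + q) (fun t => ?_) (fun t ht => ?_)
  · rwa [show x + q - (x + p) = q - p by ring] at h
  · rw [abs_mul]
    exact mul_le_mul (hA _) (hB _) (abs_nonneg _) ((abs_nonneg _).trans (hA 0))
  · rw [hαs, zero_mul]
    contrapose! ht
    exact ⟨by linarith [ht.1], by linarith [ht.2]⟩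

theorem gapFun_eq_zero_of_lt_abs {φ : ℝ → ℂ} (hαs : ∀ x, x ∉ Icc p q → α x = 0)
    (hβs : ∀ x, x ∉ Icc p' q' → β x = 0) (hgap : q < p') {w : ℝ × ℝ} (h : q' - p < |w.1 - w.2|) :
    gapFun φ α β w = 0 := by
  rw [gapFun, corr_eq_zero_of_sub_notMem hαs hβs (fun h1 => ?_),
    corr_eq_zero_of_sub_notMem hαs hβs (fun h1 => ?_), sub_zero, smul_zero]
  all_goals
    rcases lt_abs.1 h with h | h <;> linarith [h1.1, h1.2]

theorem norm_gapFun_le (φ : 𝓢(ℝ, ℂ)) {A B : ℝ} (hA : ∀ x, |α x| ≤ A) (hB : ∀ x, |β x| ≤ B)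
    (hαs : ∀ x, x ∉ Icc p q → α x = 0) (hβs : ∀ x, x ∉ Icc p' q' → β x = 0) (hgap : q < p') {D : ℝ}
    (hD0 : 0 ≤ D) (hD : q' - p ≤ D) (w : ℝ × ℝ) :
    ‖gapFun φ α β w‖ ≤ √(D ^ 3) * (A * B * √(q - p) * ‖φ.toLp 2‖) := by
  have hA0 : 0 ≤ A := (abs_nonneg _).trans (hA 0)
  have hB0 : 0 ≤ B := (abs_nonneg _).trans (hB 0)
  rcases lt_or_ge (q' - p) |w.1 - w.2| with h | h
  · rw [gapFun_eq_zero_of_lt_abs hαs hβs hgap h, norm_zero]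
    positivity
  · have h1 : |w.1 - w.2| ^ (3 / 2 : ℝ) ≤ √(D ^ 3) := by
      rw [Real.sqrt_eq_rpow, ← Real.rpow_natCast, ← Real.rpow_mul hD0]
      norm_num
      exact Real.rpow_le_rpow (abs_nonneg _) (h.trans hD) (by norm_num)
    have h2 := norm_corr_le φ hA hB hαs w.1 w.2
    have h3 := norm_corr_le φ hA hB hαs w.2 w.1
    rw [gapFun, norm_smul, Real.norm_of_nonneg (by positivity)]
    have h4 := norm_sub_le (corr φ α β w.1 w.2) (corr φ α β w.2 w.1)
    calc 1 / 2 * |w.1 - w.2| ^ (3 / 2 : ℝ) * ‖corr φ α β w.1 w.2 - corr φ α β w.2 w.1‖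
        ≤ 1 / 2 * √(D ^ 3) * (2 * (A * B * √(q - p) * ‖φ.toLp 2‖)) := by
          gcongr
          linarith
      _ = _ := by ring

/-! ### Bumps at all scales -/

/-- A smooth bump supported in `[15/16, 17/16]`. -/
def baseBump : ContDiffBump (1 : ℝ) := ⟨1 / 32, 1 / 16, by norm_num, by norm_num⟩

/-- The normalised bump of scale `r`, supported in `[15r/16, 17r/16]`. -/
def scaledBump (r x : ℝ) : ℝ := r⁻¹ * baseBump.normed volume (r⁻¹ * x)

theorem contDiff_scaledBump (r : ℝ) : ContDiff ℝ ∞ (scaledBump r) :=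
  contDiff_const.mul (baseBump.contDiff_normed.comp (contDiff_const.mul contDiff_id))

theorem baseBump_normed_eq_zero {x : ℝ} (hx : x ∉ Icc (15 / 16 : ℝ) (17 / 16)) :
    baseBump.normed volume x = 0 := by
  rw [← Function.notMem_support, baseBump.support_normed_eq, Metric.mem_ball, Real.dist_eq]
  contrapose! hx
  have := abs_lt.1 hx
  simp only [baseBump] at this
  exact ⟨by linarith, by linarith⟩

theorem scaledBump_eq_zero {r : ℝ} (hr : 0 < r) (x : ℝ)
    (hx : x ∉ Icc (15 / 16 * r) (17 / 16 * r)) : scaledBump r x = 0 := by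
  rw [scaledBump, baseBump_normed_eq_zero, mul_zero]
  contrapose! hx
  have e : r * (r⁻¹ * x) = x := by field_simp
  constructor
  · nlinarith [mul_le_mul_of_nonneg_left hx.1 hr.le]
  · nlinarith [mul_le_mul_of_nonneg_left hx.2 hr.le]

theorem deriv_scaledBump (r x : ℝ) :
    deriv (scaledBump r) x = r⁻¹ * r⁻¹ * deriv (baseBump.normed volume) (r⁻¹ * x) := by
  have h : HasDerivAt (baseBump.normed volume) (deriv (baseBump.normed volume) (r⁻¹ * x))
      (r⁻¹ * x) :=
    ((baseBump.contDiff_normed (n := 1)).differentiable (by norm_num) _).hasDerivAt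
  have h1 := ((h.comp x ((hasDerivAt_id x).const_mul r⁻¹)).const_mul r⁻¹)
  refine (h1.deriv).trans ?_
  ring

theorem deriv_scaledBump_eq_zero {r : ℝ} (hr : 0 < r) (x : ℝ)
    (hx : x ∉ Icc (15 / 16 * r) (17 / 16 * r)) : deriv (scaledBump r) x = 0 := by
  have : scaledBump r =ᶠ[nhds x] fun _ => 0 := by
    filter_upwards [isClosed_Icc.isOpen_compl.mem_nhds hx] with y hy
    exact scaledBump_eq_zero hr y hy
  rw [this.deriv_eq, deriv_const]

theorem scaledBump_nonneg {r : ℝ} (hr : 0 < r) (x : ℝ) : 0 ≤ scaledBump r x :=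
  mul_nonneg (inv_nonneg.2 hr.le) (baseBump.nonneg_normed _)

theorem integral_scaledBump {r : ℝ} (hr : 0 < r) : ∫ x, scaledBump r x = 1 := by
  unfold scaledBump
  rw [integral_const_mul, Measure.integral_comp_mul_left (baseBump.normed volume) r⁻¹,
    baseBump.integral_normed, inv_inv, abs_of_pos hr, smul_eq_mul, mul_one,
    inv_mul_cancel₀ hr.ne']

theorem hasCompactSupport_scaledBump {r : ℝ} (hr : 0 < r) : HasCompactSupport (scaledBump r) :=
  HasCompactSupport.intro isCompact_Icc (scaledBump_eq_zero hr)

theorem integral_deriv_scaledBump {r : ℝ} (hr : 0 < r) : ∫ x, deriv (scaledBump r) x = 0 :=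
  integral_eq_zero_of_hasDerivAt_of_integrable
    (fun x => ((contDiff_scaledBump r).differentiable (by simp) x).hasDerivAt)
    (((contDiff_scaledBump r).continuous_deriv (by simp)).integrable_of_hasCompactSupport
      (hasCompactSupport_scaledBump hr).deriv)
    ((contDiff_scaledBump r).continuous.integrable_of_hasCompactSupport
      (hasCompactSupport_scaledBump hr))

/-- By scaling, one constant, read off from the base bump and its derivative, serves every `r`. -/
theorem exists_bound_scaledBump : ∃ A : ℝ, 0 < A ∧
    (∀ r : ℝ, 0 < r → ∀ x, |scaledBump r x| ≤ A * r⁻¹) ∧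
    ∀ r : ℝ, 0 < r → ∀ x, |deriv (scaledBump r) x| ≤ A * r⁻¹ * r⁻¹ := by
  obtain ⟨C, hC⟩ := (baseBump.hasCompactSupport_normed
    (μ := volume)).exists_bound_of_continuous baseBump.continuous_normed
  obtain ⟨C', hC'⟩ := (baseBump.hasCompactSupport_normed
    (μ := volume)).deriv.exists_bound_of_continuous
    ((baseBump.contDiff_normed (n := 1)).continuous_deriv le_rfl)
  refine ⟨max (max C C') 1, by positivity, fun r hr x => ?_, fun r hr x => ?_⟩
  · rw [scaledBump, abs_mul, abs_of_pos (inv_pos.2 hr), mul_comm]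
    gcongr
    exact (hC _).trans ((le_max_left _ _).trans (le_max_left _ _))
  · rw [deriv_scaledBump, abs_mul, abs_mul, abs_of_pos (inv_pos.2 hr), mul_comm, mul_assoc]
    gcongr
    exact (hC' _).trans ((le_max_right _ _).trans (le_max_left _ _))

theorem exists_eq_zero_of_notMem_Icc {φ : ℝ → ℂ} (hφ : HasCompactSupport φ) :
    ∃ R, 0 < R ∧ ∀ x, x ∉ Icc (-R) R → φ x = 0 := by
  obtain ⟨R, hR⟩ := hφ.isCompact.isBounded.subset_closedBall 0
  refine ⟨max R 1, by positivity, fun x hx => ?_⟩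
  refine image_eq_zero_of_notMem_tsupport fun h => hx ?_
  have := hR h
  rw [mem_closedBall_zero_iff, Real.norm_eq_abs] at this
  exact abs_le.1 (this.trans (le_max_left _ _))

/-- The smearing of a compactly supported test function by the bump of scale `r`. -/
def bumpSmear (φ : 𝓢(ℝ, ℂ)) (hφ : HasCompactSupport φ) (r : ℝ) (hr : 0 < r) : 𝓢(ℝ, ℂ) :=
  HasCompactSupport.toSchwartzMap (f := smear φ (scaledBump r))
    (by
      obtain ⟨R, -, hR⟩ := exists_eq_zero_of_notMem_Icc hφ
      exact HasCompactSupport.intro isCompact_Icc fun x hx =>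
        smear_eq_zero hR (scaledBump_eq_zero hr) hx)
    (contDiff_smear φ.continuous (contDiff_scaledBump r) (scaledBump_eq_zero hr))

theorem bumpSmear_apply (φ : 𝓢(ℝ, ℂ)) (hφ : HasCompactSupport φ) (r : ℝ) (hr : 0 < r) (x : ℝ) :
    bumpSmear φ hφ r hr x = smear φ (scaledBump r) x := rfl

/-! ### Estimates for distributions with integrable fractional gradient -/

theorem norm_toDistribution_le (F : Lp ℂ 1 offDiagMeasure) (G : offDiagSchwartz) {M : ℝ}
    (hM : ∀ w, ‖(G : 𝓢(ℝ × ℝ, ℂ)) w‖ ≤ M) : ‖L1od.toDistribution F G‖ ≤ M * ‖F‖ := by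
  have hF : Integrable F offDiagMeasure := L1.integrable_coeFn F
  rw [L1od.toDistribution_apply, L1.norm_eq_integral_norm, ← integral_const_mul]
  refine norm_integral_le_of_norm_le (hF.norm.const_mul _)
    (Filter.Eventually.of_forall fun w => ?_)
  rw [norm_mul, mul_comm]
  exact mul_le_mul_of_nonneg_right (hM w) (norm_nonneg _)

theorem apply_fracDiv {u : 𝓢'(ℝ, ℂ)} {F : Lp ℂ 1 offDiagMeasure}
    (h : fracGrad u = L1od.toDistribution F) (G : offDiagSchwartz) :
    u (fracDiv G) = L1od.toDistribution F G := by
  rw [← h]; rfl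

theorem norm_sum_le_of_at_most_one {ι E : Type*} [NormedAddCommGroup E] (s : Finset ι)
    (f : ι → E) {M : ℝ} (hM : 0 ≤ M) (hf : ∀ i, ‖f i‖ ≤ M)
    (h : ∀ i j, f i ≠ 0 → f j ≠ 0 → i = j) : ‖∑ i ∈ s, f i‖ ≤ M := by
  by_cases h0 : ∃ i ∈ s, f i ≠ 0
  · obtain ⟨i, hi, hi0⟩ := h0
    rw [Finset.sum_eq_single i (fun j _ hj => by_contra fun hj0 => hj (h j i hj0 hi0))
      (fun h => absurd hi h)]
    exact hf i
  · push Not at h0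
    rw [Finset.sum_eq_zero h0, norm_zero]
    exact hM

/-- The band has `|x - y| ≤ 19r/16`; enlarging this to `2r` makes the product with the
Cauchy–Schwarz factor `√(r/8)` exactly `r²`, which cancels the two bump heights `A/r` and `A/(2r)`.
-/
theorem sqrt_pow_three_mul_sqrt {r : ℝ} (hr : 0 < r) :
    √((2 * r) ^ 3) * √(17 / 16 * r - 15 / 16 * r) = r ^ 2 := by
  rw [← Real.sqrt_mul (by positivity), Real.sqrt_eq_iff_mul_self_eq (by nlinarith [pow_pos hr 4])
    (by positivity)]
  ring

variable {A : ℝ}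

theorem exists_offDiag_scale (hA : ∀ r : ℝ, 0 < r → ∀ x, |scaledBump r x| ≤ A * r⁻¹)
    (φ : 𝓢(ℝ, ℂ)) (hφ : HasCompactSupport φ) {r : ℝ} (hr : 0 < r) :
    ∃ G : offDiagSchwartz,
      fracDiv G = bumpSmear φ hφ r hr - bumpSmear φ hφ (2 * r) (by positivity) ∧
      (∀ w, ‖(G : 𝓢(ℝ × ℝ, ℂ)) w‖ ≤ A ^ 2 * ‖φ.toLp 2‖) ∧
      ∀ w, (G : 𝓢(ℝ × ℝ, ℂ)) w ≠ 0 →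
        |w.1 - w.2| ∈ Icc (13 / 16 * r) (19 / 16 * r) := by
  obtain ⟨R, -, hR⟩ := exists_eq_zero_of_notMem_Icc hφ
  have hr2 : 0 < 2 * r := by positivity
  obtain ⟨G, hG, hdiv⟩ := exists_offDiag_gapFun φ.continuous hR (contDiff_scaledBump r)
    (scaledBump_eq_zero hr) (contDiff_scaledBump (2 * r)) (scaledBump_eq_zero hr2) (by linarith)
  refine ⟨G, ?_, fun w => ?_, fun w hw => ?_⟩
  · ext x
    rw [hdiv, integral_scaledBump hr, integral_scaledBump hr2]
    simp [bumpSmear_apply]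
  · rw [hG]
    refine (norm_gapFun_le φ (hA r hr) (hA _ hr2) (scaledBump_eq_zero hr)
      (scaledBump_eq_zero hr2) (by linarith) hr2.le (by linarith) w).trans ?_
    calc _ = (√((2 * r) ^ 3) * √(17 / 16 * r - 15 / 16 * r)) *
          (A * r⁻¹ * (A * (2 * r)⁻¹)) * ‖φ.toLp 2‖ := by ring
      _ = A ^ 2 / 2 * ‖φ.toLp 2‖ := by
        rw [sqrt_pow_three_mul_sqrt hr]
        field_simp
      _ ≤ _ := by
        gcongr
        nlinarith [sq_nonneg A]
  · rw [hG] at hw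
    constructor
    · by_contra! h
      exact hw (gapFun_eq_zero_of_abs_lt (scaledBump_eq_zero hr) (scaledBump_eq_zero hr2)
        (by linarith))
    · by_contra! h
      exact hw (gapFun_eq_zero_of_lt_abs (scaledBump_eq_zero hr) (scaledBump_eq_zero hr2)
        (by linarith) (by linarith))

/-- Consecutive bands are disjoint because `19/16 < 2 · 13/16`; this is why the base bump is so
narrow. -/
theorem eq_of_dyadic_mem {r d : ℝ} (hr : 0 < r) {i j : ℕ}
    (hi : d ∈ Icc (13 / 16 * (2 ^ i * r)) (19 / 16 * (2 ^ i * r)))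
    (hj : d ∈ Icc (13 / 16 * (2 ^ j * r)) (19 / 16 * (2 ^ j * r))) : i = j := by
  have key : ∀ {i j : ℕ}, d ≤ 19 / 16 * (2 ^ i * r) → 13 / 16 * (2 ^ j * r) ≤ d → j ≤ i := by
    intro i j h1 h2
    by_contra! h
    have h3 : (2 : ℝ) ^ (i + 1) ≤ 2 ^ j := pow_le_pow_right₀ (by norm_num) h
    have h4 : (2 : ℝ) ^ (i + 1) * r ≤ 2 ^ j * r := mul_le_mul_of_nonneg_right h3 hr.le
    have h5 : 0 < (2 : ℝ) ^ i * r := by positivity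
    rw [pow_succ] at h4
    nlinarith
  exact le_antisymm (key hj.2 hi.1) (key hi.2 hj.1)

theorem norm_bumpSmear_sub_le (hA : ∀ r : ℝ, 0 < r → ∀ x, |scaledBump r x| ≤ A * r⁻¹)
    {u : 𝓢'(ℝ, ℂ)} {F : Lp ℂ 1 offDiagMeasure} (h : fracGrad u = L1od.toDistribution F)
    (φ : 𝓢(ℝ, ℂ)) (hφ : HasCompactSupport φ) {r : ℝ} (hr : 0 < r) (n : ℕ) :
    ‖u (bumpSmear φ hφ r hr) - u (bumpSmear φ hφ (2 ^ n * r) (by positivity))‖ ≤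
      A ^ 2 * ‖φ.toLp 2‖ * ‖F‖ := by
  choose G hdiv hbd hsupp using fun j : ℕ =>
    exists_offDiag_scale hA φ hφ (r := 2 ^ j * r) (by positivity)
  have hsum : u (bumpSmear φ hφ r hr) - u (bumpSmear φ hφ (2 ^ n * r) (by positivity)) =
      L1od.toDistribution F (∑ j ∈ Finset.range n, G j) := by
    rw [map_sum]
    have e : ∀ j, L1od.toDistribution F (G j) =
        u (bumpSmear φ hφ (2 ^ j * r) (by positivity)) -
          u (bumpSmear φ hφ (2 ^ (j + 1) * r) (by positivity)) := by
      intro j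
      rw [← apply_fracDiv h, hdiv, map_sub]
      congr 3
      ring
    simp only [e]
    rw [Finset.sum_range_sub' (fun j => u (bumpSmear φ hφ (2 ^ j * r) (by positivity)))]
    simp
  rw [hsum]
  refine norm_toDistribution_le F _ fun w => ?_
  have : ((∑ j ∈ Finset.range n, G j : offDiagSchwartz) : 𝓢(ℝ × ℝ, ℂ)) w =
      ∑ j ∈ Finset.range n, (G j : 𝓢(ℝ × ℝ, ℂ)) w := by
    simp
  rw [this]
  -- At each point at most one scale contributes, so the bound does not grow with `n`.
  exact norm_sum_le_of_at_most_one _ _ (by positivity) (fun j => hbd j w)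
    fun i j hi hj => eq_of_dyadic_mem hr (hsupp i w hi) (hsupp j w hj)

/-! ### Decay at large scales for derivatives of test functions -/

theorem smear_deriv (ψ : 𝓢(ℝ, ℂ)) (hα : ContDiff ℝ 1 α) (hαc : HasCompactSupport α) (x : ℝ) :
    smear (fun t => deriv ψ t) α x = -smear ψ (deriv α) x := by
  have hψ' : Continuous (deriv ψ) := (SchwartzMap.derivCLM ℂ ℂ ψ).continuous
  have hαx : Continuous fun t => α (t - x) := hα.continuous.comp (by fun_prop)
  have hαx' : Continuous fun t => deriv α (t - x) :=
    (hα.continuous_deriv le_rfl).comp (by fun_prop)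
  have hc : HasCompactSupport fun t => α (t - x) :=
    hαc.comp_homeomorph (Homeomorph.subRight x)
  have hc' : HasCompactSupport fun t => deriv α (t - x) :=
    hαc.deriv.comp_homeomorph (Homeomorph.subRight x)
  refine integral_bilinear_hasDerivAt_right_eq_neg_left_of_integrable
    (L := (ContinuousLinearMap.lsmul ℝ ℝ : ℝ →L[ℝ] ℂ →L[ℝ] ℂ))
    (u := fun t => α (t - x)) (u' := fun t => deriv α (t - x)) (v := ψ) (v' := deriv ψ)
    (fun t _ => ?_) (fun t _ => ψ.differentiableAt.hasDerivAt) ?_ ?_ ?_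
  · have h1 : HasDerivAt α (deriv α (t - x)) (t - x) :=
      (hα.differentiable one_ne_zero _).hasDerivAt
    simpa using h1.comp_sub_const t x
  · exact (hαx.smul hψ').integrable_of_hasCompactSupport hc.smul_right
  · exact (hαx'.smul ψ.continuous).integrable_of_hasCompactSupport hc'.smul_right
  · exact (hαx.smul ψ.continuous).integrable_of_hasCompactSupport hc.smul_right

/-- The pair of bumps is now the derivative at scale `r` and the bump at scale `2r`. The derivative
has integral zero, so the smearing at scale `2r` drops out of the divergence, and its size
contributes the extra `r⁻¹`. -/
theorem norm_bumpSmear_deriv_le (hA : ∀ r : ℝ, 0 < r → ∀ x, |scaledBump r x| ≤ A * r⁻¹)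
    (hA' : ∀ r : ℝ, 0 < r → ∀ x, |deriv (scaledBump r) x| ≤ A * r⁻¹ * r⁻¹)
    {u : 𝓢'(ℝ, ℂ)} {F : Lp ℂ 1 offDiagMeasure} (h : fracGrad u = L1od.toDistribution F)
    (ψ : 𝓢(ℝ, ℂ)) (hψ : HasCompactSupport ψ)
    (hψ' : HasCompactSupport (SchwartzMap.derivCLM ℂ ℂ ψ)) {r : ℝ} (hr : 0 < r) :
    ‖u (bumpSmear (SchwartzMap.derivCLM ℂ ℂ ψ) hψ' r hr)‖ ≤
      A ^ 2 * r⁻¹ * ‖ψ.toLp 2‖ * ‖F‖ := by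
  obtain ⟨R, -, hR⟩ := exists_eq_zero_of_notMem_Icc hψ
  have hr2 : 0 < 2 * r := by positivity
  obtain ⟨G, hG, hdiv⟩ := exists_offDiag_gapFun ψ.continuous hR
    (α := deriv (scaledBump r)) (contDiff_infty_iff_deriv.1 (contDiff_scaledBump r)).2
    (deriv_scaledBump_eq_zero hr) (contDiff_scaledBump (2 * r)) (scaledBump_eq_zero hr2)
    (by linarith)
  have e : bumpSmear (SchwartzMap.derivCLM ℂ ℂ ψ) hψ' r hr = -fracDiv G := by
    ext x
    have := smear_deriv ψ ((contDiff_scaledBump r).of_le (by simp))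
      (hasCompactSupport_scaledBump hr) x
    rw [neg_apply, hdiv, integral_scaledBump hr2, integral_deriv_scaledBump hr]
    rw [Complex.ofReal_one, Complex.ofReal_zero, one_mul, zero_mul, sub_zero, ← this]
    rfl
  rw [e, map_neg, norm_neg, apply_fracDiv h]
  refine norm_toDistribution_le F _ fun w => ?_
  rw [hG]
  refine (norm_gapFun_le ψ (hA' r hr) (hA _ hr2) (deriv_scaledBump_eq_zero hr)
    (scaledBump_eq_zero hr2) (by linarith) hr2.le (by linarith) w).trans ?_
  calc _ = (√((2 * r) ^ 3) * √(17 / 16 * r - 15 / 16 * r)) *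
        (A * r⁻¹ * r⁻¹ * (A * (2 * r)⁻¹)) * ‖ψ.toLp 2‖ := by ring
    _ = A ^ 2 * r⁻¹ / 2 * ‖ψ.toLp 2‖ := by
      rw [sqrt_pow_three_mul_sqrt hr]
      field_simp
    _ ≤ _ := by
      gcongr
      have : 0 ≤ A ^ 2 * r⁻¹ := by positivity
      linarith

end

noncomputable section

/-! ### Smearing is an approximate identity on test functions -/

/-- A smearing is the convolution with the reflected bump, and the derivative may fall on `f`. -/
theorem deriv_smear {f : ℝ → ℂ} {α : ℝ → ℝ} (hf : ContDiff ℝ 1 f) (hfc : HasCompactSupport f)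
    (hα : Continuous α) : deriv (smear f α) = smear (deriv f) α := by
  have e : ∀ g : ℝ → ℂ, smear g α = convolution g (fun s => α (-s))
      (ContinuousLinearMap.lsmul ℝ ℝ : ℝ →L[ℝ] ℂ →L[ℝ] ℂ).flip volume := by
    intro g
    funext x
    simp only [smear, convolution, ContinuousLinearMap.flip_apply,
      ContinuousLinearMap.lsmul_apply, neg_sub]
  funext x
  rw [e, e]
  exact (hfc.hasDerivAt_convolution_left _ hf
    (hα.comp continuous_neg).locallyIntegrable x).deriv

theorem hasCompactSupport_iteratedDeriv {f : ℝ → ℂ} (hfc : HasCompactSupport f) (n : ℕ) :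
    HasCompactSupport (iteratedDeriv n f) := by
  induction n with
  | zero => simpa using hfc
  | succ n ih => rw [iteratedDeriv_succ]; exact ih.deriv

theorem contDiff_iteratedDeriv {f : ℝ → ℂ} (hf : ContDiff ℝ ∞ f) (n : ℕ) :
    ContDiff ℝ ∞ (iteratedDeriv n f) := by
  induction n with
  | zero => simpa using hf
  | succ n ih => rw [iteratedDeriv_succ]; exact (contDiff_infty_iff_deriv.1 ih).2

theorem iteratedDeriv_smear {f : ℝ → ℂ} {α : ℝ → ℝ} (hf : ContDiff ℝ ∞ f)
    (hfc : HasCompactSupport f) (hα : Continuous α) (n : ℕ) :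
    iteratedDeriv n (smear f α) = smear (iteratedDeriv n f) α := by
  induction n with
  | zero => simp
  | succ n ih =>
    rw [iteratedDeriv_succ, ih, iteratedDeriv_succ]
    exact deriv_smear ((contDiff_iteratedDeriv hf n).of_le (by simp))
      (hasCompactSupport_iteratedDeriv hfc n) hα

theorem norm_smear_scaledBump_sub_le {f : ℝ → ℂ} (hf : Continuous f) {M r : ℝ} (hr : 0 < r)
    (hM0 : 0 ≤ M) (hM : ∀ x y, ‖f x - f y‖ ≤ M * |x - y|) (x : ℝ) :
    ‖smear f (scaledBump r) x - f x‖ ≤ 2 * M * r := by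
  have hc : Continuous fun t => scaledBump r (t - x) :=
    (contDiff_scaledBump r).continuous.comp (by fun_prop)
  have hs : HasCompactSupport fun t => scaledBump r (t - x) :=
    (hasCompactSupport_scaledBump hr).comp_homeomorph (Homeomorph.subRight x)
  have h1 : ∫ t, scaledBump r (t - x) = 1 := by
    rw [integral_sub_right_eq_self (scaledBump r) x, integral_scaledBump hr]
  have e : smear f (scaledBump r) x - f x = ∫ t, scaledBump r (t - x) • (f t - f x) := by
    have i1 : Integrable fun t => scaledBump r (t - x) • f t :=
      (hc.smul hf).integrable_of_hasCompactSupport hs.smul_right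
    have i2 : Integrable fun t => scaledBump r (t - x) • f x :=
      (hc.smul continuous_const).integrable_of_hasCompactSupport hs.smul_right
    simp only [smul_sub]
    rw [integral_sub i1 i2, integral_smul_const, h1, one_smul, smear]
  rw [e]
  have hi : Integrable fun t => scaledBump r (t - x) * (2 * M * r) :=
    (hc.integrable_of_hasCompactSupport hs).mul_const _
  refine (norm_integral_le_of_norm_le hi (Filter.Eventually.of_forall fun t => ?_)).trans_eq ?_
  · rw [norm_smul, Real.norm_of_nonneg (scaledBump_nonneg hr _)]
    by_cases ht : t - x ∈ Icc (15 / 16 * r) (17 / 16 * r)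
    · refine mul_le_mul_of_nonneg_left ((hM t x).trans ?_) (scaledBump_nonneg hr _)
      have : |t - x| ≤ 2 * r := abs_le.2 ⟨by linarith [ht.1], by linarith [ht.2]⟩
      nlinarith
    · simp [scaledBump_eq_zero hr _ ht]
  · rw [integral_mul_const, h1, one_mul]

theorem exists_seminorm_bumpSmear_sub_le (φ : 𝓢(ℝ, ℂ)) (hφ : HasCompactSupport φ) (k n : ℕ) :
    ∃ C : ℝ, ∀ (r : ℝ) (hr : 0 < r), r ≤ 1 →
      SchwartzMap.seminorm ℂ k n (bumpSmear φ hφ r hr - φ) ≤ C * r := by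
  have hsm := φ.smooth ⊤
  have hgc := hasCompactSupport_iteratedDeriv hφ n
  have hgd := contDiff_iteratedDeriv hsm n
  obtain ⟨R, hR0, hR⟩ := exists_eq_zero_of_notMem_Icc hgc
  have hM : ∀ x y, ‖iteratedDeriv n φ x - iteratedDeriv n φ y‖ ≤
      SchwartzMap.seminorm ℂ 0 (n + 1) φ * |x - y| := by
    intro x y
    refine convex_univ.norm_image_sub_le_of_norm_deriv_le (𝕜 := ℝ)
      (fun t _ => hgd.differentiable (by simp) t) (fun t _ => ?_) (mem_univ y) (mem_univ x)
    rw [← iteratedDeriv_succ, ← norm_iteratedFDeriv_eq_norm_iteratedDeriv]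
    exact SchwartzMap.norm_iteratedFDeriv_le_seminorm ℂ φ (n + 1) t
  set M := SchwartzMap.seminorm ℂ 0 (n + 1) φ
  have hM0 : 0 ≤ M := apply_nonneg _ _
  -- For `r ≤ 1` the smearing moves the support by at most `17/16 < 2`, so only `|x| ≤ R + 2`
  -- matters.
  refine ⟨(R + 2) ^ k * (2 * M), fun r hr hr1 => ?_⟩
  refine SchwartzMap.seminorm_le_bound' ℂ k n _ (by positivity) fun x => ?_
  have e : iteratedDeriv n (bumpSmear φ hφ r hr - φ) x =
      smear (iteratedDeriv n φ) (scaledBump r) x - iteratedDeriv n φ x := by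
    rw [← iteratedDeriv_smear hsm hφ (contDiff_scaledBump r).continuous]
    exact iteratedDeriv_sub ((bumpSmear φ hφ r hr).contDiffAt n) (φ.contDiffAt n)
  rw [e]
  by_cases hx : |x| ≤ R + 2
  · have := norm_smear_scaledBump_sub_le hgd.continuous hr hM0 hM x
    calc _ ≤ (R + 2) ^ k * (2 * M * r) := by gcongr
      _ = _ := by ring
  · have hx1 : x ∉ Icc (-R) R := fun h => hx ((abs_le.2 h).trans (by linarith))
    have hx2 : x ∉ Icc (-R - 17 / 16 * r) (R - 15 / 16 * r) := fun h =>
      hx (abs_le.2 ⟨by linarith [h.1], by linarith [h.2]⟩)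
    rw [hR x hx1, smear_eq_zero hR (scaledBump_eq_zero hr) hx2, sub_zero, norm_zero, mul_zero]
    positivity

theorem tendsto_bumpSmear (φ : 𝓢(ℝ, ℂ)) (hφ : HasCompactSupport φ) :
    Filter.Tendsto (fun n : ℕ => bumpSmear φ hφ (1 / ((n : ℝ) + 1)) (by positivity)) Filter.atTop
      (nhds φ) := by
  rw [(schwartz_withSeminorms ℂ ℝ ℂ).tendsto_nhds]
  rintro ⟨k, m⟩ ε hε
  obtain ⟨C, hC⟩ := exists_seminorm_bumpSmear_sub_le φ hφ k m
  have h : Filter.Tendsto (fun n : ℕ => C * (1 / ((n : ℝ) + 1))) Filter.atTop (nhds 0) := by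
    simpa using tendsto_one_div_add_atTop_nhds_zero_nat.const_mul C
  filter_upwards [h.eventually_lt_const hε] with n hn
  refine (hC _ (by positivity) ?_).trans_lt hn
  rw [div_le_one (by positivity)]
  linarith [(Nat.cast_nonneg n : (0 : ℝ) ≤ n)]

/-! ### Compactly supported primitives and the estimate on mean-zero test functions -/

/-- The primitive from the left vanishes to the right of the support precisely because the total
integral is zero. -/
theorem exists_compactSupport_primitive (φ : 𝓢(ℝ, ℂ)) (hφ : HasCompactSupport φ)
    (h0 : ∫ x, φ x = 0) :
    ∃ ψ : 𝓢(ℝ, ℂ), HasCompactSupport ψ ∧ SchwartzMap.derivCLM ℂ ℂ ψ = φ := by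
  obtain ⟨R, hR0, hR⟩ := exists_eq_zero_of_notMem_Icc hφ
  -- Starting at `-R - 1` puts `[-R, R]`, left endpoint included, inside the half-open interval of
  -- integration when `x > R`.
  set g : ℝ → ℂ := fun x => ∫ t in (-R - 1)..x, φ t with hg
  have hd : ∀ x, HasDerivAt g (φ x) x := fun x =>
    intervalIntegral.integral_hasDerivAt_right (φ.continuous.intervalIntegrable _ _)
      φ.continuous.stronglyMeasurable.stronglyMeasurableAtFilter φ.continuous.continuousAt
  have hder : deriv g = φ := funext fun x => (hd x).deriv
  have hgd : ContDiff ℝ ∞ g := by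
    rw [contDiff_infty_iff_deriv, hder]
    exact ⟨fun x => (hd x).differentiableAt, φ.smooth ⊤⟩
  have hgc : HasCompactSupport g := by
    refine HasCompactSupport.intro (isCompact_Icc (a := -R) (b := R)) fun x hx => ?_
    rcases lt_or_ge x (-R) with h | h
    · refine intervalIntegral.integral_zero_ae (Filter.Eventually.of_forall fun t ht => hR t ?_)
      intro h1
      have := ht.2
      rcases le_max_iff.1 this with h2 | h2 <;> linarith [h1.1]
    · have hxR : R < x := by
        by_contra! h1
        exact hx ⟨h, h1⟩
      rw [hg]
      simp only
      rw [intervalIntegral.integral_of_le (by linarith), ← h0]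
      refine setIntegral_eq_integral_of_forall_compl_eq_zero fun t ht => hR t fun h1 => ht ?_
      exact ⟨by linarith [h1.1], by linarith [h1.2]⟩
  refine ⟨hgc.toSchwartzMap hgd, hgc, ?_⟩
  ext x
  exact congrFun hder x

/-- For fixed `r`, letting `n → ∞` removes the term at scale `2^n r`; then `r → 0` recovers `φ`. -/
theorem norm_apply_le_of_integral_eq_zero {A : ℝ}
    (hA : ∀ r : ℝ, 0 < r → ∀ x, |scaledBump r x| ≤ A * r⁻¹)
    (hA' : ∀ r : ℝ, 0 < r → ∀ x, |deriv (scaledBump r) x| ≤ A * r⁻¹ * r⁻¹)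
    {u : 𝓢'(ℝ, ℂ)} {F : Lp ℂ 1 offDiagMeasure} (h : fracGrad u = L1od.toDistribution F)
    (φ : 𝓢(ℝ, ℂ)) (hφ : HasCompactSupport φ) (h0 : ∫ x, φ x = 0) :
    ‖u φ‖ ≤ A ^ 2 * ‖φ.toLp 2‖ * ‖F‖ := by
  obtain ⟨ψ, hψ, rfl⟩ := exists_compactSupport_primitive φ hφ h0
  set φ := SchwartzMap.derivCLM ℂ ℂ ψ
  have hr : ∀ r (hr : 0 < r), ‖u (bumpSmear φ hφ r hr)‖ ≤ A ^ 2 * ‖φ.toLp 2‖ * ‖F‖ := by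
    intro r hr
    have hlim : Filter.Tendsto (fun n : ℕ => A ^ 2 * ‖φ.toLp 2‖ * ‖F‖ +
        A ^ 2 * (2 ^ n * r)⁻¹ * ‖ψ.toLp 2‖ * ‖F‖) Filter.atTop
        (nhds (A ^ 2 * ‖φ.toLp 2‖ * ‖F‖ + A ^ 2 * 0 * ‖ψ.toLp 2‖ * ‖F‖)) := by
      have h1 : Filter.Tendsto (fun n : ℕ => ((2 : ℝ) ^ n * r)⁻¹) Filter.atTop (nhds 0) :=
        ((tendsto_pow_atTop_atTop_of_one_lt one_lt_two).atTop_mul_const hr).inv_tendsto_atTop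
      exact tendsto_const_nhds.add (((h1.const_mul _).mul_const _).mul_const _)
    simp only [mul_zero, zero_mul, add_zero] at hlim
    refine ge_of_tendsto' hlim fun n => ?_
    have h1 := norm_bumpSmear_sub_le hA h φ hφ hr n
    have h2 := norm_bumpSmear_deriv_le hA hA' h ψ hψ hφ (r := 2 ^ n * r) (by positivity)
    refine le_trans ?_ (add_le_add h1 h2)
    refine le_trans (le_of_eq ?_) (norm_add_le _ _)
    rw [sub_add_cancel]
  exact le_of_tendsto' ((u.continuous.tendsto φ).comp (tendsto_bumpSmear φ hφ)).norm
    fun n => hr _ _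

/-! ### Density of compactly supported functions in the Schwartz space -/

/-- A smooth cutoff equal to `1` on `[-1, 1]` and supported in `[-2, 2]`. -/
def cutoffBump : ContDiffBump (0 : ℝ) := ⟨1, 2, one_pos, one_lt_two⟩

/-- The cutoff as a compactly supported Schwartz function. -/
def cutoffSchwartz : 𝓢(ℝ, ℂ) :=
  (cutoffBump.hasCompactSupport.comp_left (g := Complex.ofReal) rfl).toSchwartzMap
    (Complex.ofRealCLM.contDiff.comp cutoffBump.contDiff)

theorem cutoffSchwartz_apply (x : ℝ) : cutoffSchwartz x = (cutoffBump x : ℂ) := rfl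

theorem hasCompactSupport_cutoffSchwartz_scale {R : ℝ} (hR : 0 < R) :
    HasCompactSupport fun x => cutoffSchwartz (R⁻¹ * x) :=
  (cutoffBump.hasCompactSupport.comp_left (g := Complex.ofReal) rfl).comp_homeomorph
    (Homeomorph.mulLeft₀ R⁻¹ (inv_ne_zero hR.ne'))

/-- The product of a Schwartz function with the cutoff at scale `R`. -/
def truncate (φ : 𝓢(ℝ, ℂ)) (R : ℝ) (hR : 0 < R) : 𝓢(ℝ, ℂ) :=
  HasCompactSupport.toSchwartzMap (f := fun x => cutoffSchwartz (R⁻¹ * x) * φ x)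
    (hasCompactSupport_cutoffSchwartz_scale hR).mul_right
    (((cutoffSchwartz.smooth ⊤).comp (contDiff_const.mul contDiff_id)).mul (φ.smooth ⊤))

theorem hasCompactSupport_truncate (φ : 𝓢(ℝ, ℂ)) {R : ℝ} (hR : 0 < R) :
    HasCompactSupport (truncate φ R hR) :=
  (hasCompactSupport_cutoffSchwartz_scale hR).mul_right

theorem norm_iteratedFDeriv_cutoffSchwartz_scale_le {R : ℝ} (hR : 1 ≤ R) (i : ℕ) (x : ℝ) :
    ‖iteratedFDeriv ℝ i (fun x => cutoffSchwartz (R⁻¹ * x)) x‖ ≤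
      SchwartzMap.seminorm ℂ 0 i cutoffSchwartz := by
  have e : iteratedDeriv i (fun x => cutoffSchwartz (R⁻¹ * x)) x =
      R⁻¹ ^ i • iteratedDeriv i cutoffSchwartz (R⁻¹ * x) :=
    congrFun (iteratedDeriv_comp_const_smul (cutoffSchwartz.smooth i) R⁻¹) x
  rw [norm_iteratedFDeriv_eq_norm_iteratedDeriv, e, norm_smul,
    ← norm_iteratedFDeriv_eq_norm_iteratedDeriv]
  have h1 : ‖R⁻¹ ^ i‖ ≤ 1 := by
    rw [norm_pow, Real.norm_of_nonneg (by positivity)]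
    exact pow_le_one₀ (by positivity) (inv_le_one_of_one_le₀ hR)
  calc _ ≤ 1 * SchwartzMap.seminorm ℂ 0 i cutoffSchwartz := by
        gcongr
        exact SchwartzMap.norm_iteratedFDeriv_le_seminorm ℂ _ i _
    _ = _ := one_mul _

/-- The difference vanishes for `|x| < R`; elsewhere `1 ≤ |x| / R` trades one extra power of decay
of `φ` for the factor `R⁻¹`. -/
theorem exists_seminorm_truncate_sub_le (φ : 𝓢(ℝ, ℂ)) (k n : ℕ) :
    ∃ C : ℝ, ∀ (R : ℝ) (hR : 0 < R), 1 ≤ R →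
      SchwartzMap.seminorm ℂ k n (truncate φ R hR - φ) ≤ C * R⁻¹ := by
  refine ⟨(∑ i ∈ Finset.range (n + 1), (n.choose i : ℝ) *
    SchwartzMap.seminorm ℂ 0 i cutoffSchwartz * SchwartzMap.seminorm ℂ (k + 1) (n - i) φ) +
    SchwartzMap.seminorm ℂ (k + 1) n φ, fun R hR hR1 => ?_⟩
  refine SchwartzMap.seminorm_le_bound ℂ k n _ (by positivity) fun x => ?_
  have e' : iteratedFDeriv ℝ n (⇑(truncate φ R hR - φ)) x =
      iteratedFDeriv ℝ n (⇑(truncate φ R hR) - ⇑φ) x := rfl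
  rcases lt_or_ge |x| R with hx | hx
  · have hz : ⇑(truncate φ R hR - φ) =ᶠ[nhds x] 0 := by
      filter_upwards [(isOpen_lt continuous_abs continuous_const).mem_nhds hx] with y hy
      have h1 : cutoffBump (R⁻¹ * y) = 1 := by
        refine cutoffBump.one_of_mem_closedBall ?_
        rw [mem_closedBall_zero_iff, norm_mul, Real.norm_of_nonneg (by positivity),
          Real.norm_eq_abs, inv_mul_le_iff₀ hR]
        simpa [cutoffBump] using (le_of_lt hy : |y| ≤ R)
      have h2 : truncate φ R hR y = cutoffSchwartz (R⁻¹ * y) * φ y := rfl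
      rw [sub_apply, h2, cutoffSchwartz_apply, h1]
      simp
    have hz' := (Filter.EventuallyEq.iteratedFDeriv (𝕜 := ℝ) hz n).eq_of_nhds
    rw [hz', Pi.zero_def, iteratedFDeriv_fun_zero, Pi.zero_apply, norm_zero, mul_zero]
    positivity
  · have hw : ‖x‖ ^ k ≤ R⁻¹ * ‖x‖ ^ (k + 1) := by
      rw [pow_succ, Real.norm_eq_abs]
      rw [← div_eq_inv_mul, le_div_iff₀ hR]
      exact mul_le_mul_of_nonneg_left hx (by positivity)
    have h1 : ‖iteratedFDeriv ℝ n (truncate φ R hR) x‖ ≤ ∑ i ∈ Finset.range (n + 1),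
        (n.choose i : ℝ) * SchwartzMap.seminorm ℂ 0 i cutoffSchwartz *
          ‖iteratedFDeriv ℝ (n - i) φ x‖ := by
      refine (norm_iteratedFDeriv_mul_le (N := ∞)
        ((cutoffSchwartz.smooth ⊤).comp (contDiff_const.mul contDiff_id)) (φ.smooth ⊤) x
        (mod_cast le_top)).trans (Finset.sum_le_sum fun i _ => ?_)
      gcongr
      exact norm_iteratedFDeriv_cutoffSchwartz_scale_le hR1 i x
    rw [e', iteratedFDeriv_sub_apply ((truncate φ R hR).contDiffAt n) (φ.contDiffAt n)]
    calc ‖x‖ ^ k * ‖iteratedFDeriv ℝ n (truncate φ R hR) x - iteratedFDeriv ℝ n φ x‖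
        ≤ (R⁻¹ * ‖x‖ ^ (k + 1)) * ((∑ i ∈ Finset.range (n + 1),
          (n.choose i : ℝ) * SchwartzMap.seminorm ℂ 0 i cutoffSchwartz *
            ‖iteratedFDeriv ℝ (n - i) φ x‖) + ‖iteratedFDeriv ℝ n φ x‖) := by
          gcongr
          exact (norm_sub_le _ _).trans (add_le_add_left h1 _)
      _ = ((∑ i ∈ Finset.range (n + 1),
          (n.choose i : ℝ) * SchwartzMap.seminorm ℂ 0 i cutoffSchwartz *
            (‖x‖ ^ (k + 1) * ‖iteratedFDeriv ℝ (n - i) φ x‖)) +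
              ‖x‖ ^ (k + 1) * ‖iteratedFDeriv ℝ n φ x‖) * R⁻¹ := by
          rw [mul_assoc, mul_add, Finset.mul_sum, mul_comm]
          congr 3
          funext i
          ring
      _ ≤ _ := by
          gcongr
          · exact SchwartzMap.le_seminorm ℂ _ _ φ x
          · exact SchwartzMap.le_seminorm ℂ _ _ φ x

theorem tendsto_truncate (φ : 𝓢(ℝ, ℂ)) :
    Filter.Tendsto (fun n : ℕ => truncate φ ((n : ℝ) + 1) (by positivity)) Filter.atTop
      (nhds φ) := by
  rw [(schwartz_withSeminorms ℂ ℝ ℂ).tendsto_nhds]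
  rintro ⟨k, m⟩ ε hε
  obtain ⟨C, hC⟩ := exists_seminorm_truncate_sub_le φ k m
  have h : Filter.Tendsto (fun n : ℕ => C * ((n : ℝ) + 1)⁻¹) Filter.atTop (nhds 0) := by
    simpa using tendsto_one_div_add_atTop_nhds_zero_nat.const_mul C
  filter_upwards [h.eventually_lt_const hε] with n hn
  exact (hC _ (by positivity) (by linarith [(Nat.cast_nonneg n : (0 : ℝ) ≤ n)])).trans_lt hn

theorem eq_of_eq_on_hasCompactSupport {u v : 𝓢'(ℝ, ℂ)}
    (h : ∀ φ : 𝓢(ℝ, ℂ), HasCompactSupport φ → u φ = v φ) : u = v := by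
  ext φ
  refine tendsto_nhds_unique ((u.continuous.tendsto φ).comp (tendsto_truncate φ)) ?_
  refine ((v.continuous.tendsto φ).comp (tendsto_truncate φ)).congr fun n => ?_
  exact (h _ (hasCompactSupport_truncate φ _)).symm

end

noncomputable section

/-! ### Representation of `L²`-bounded distributions -/

/-- Schwartz functions embed injectively in `L²`, so `u` becomes a bounded functional on the image
of `D`. Hahn–Banach extends it without increasing the norm, and Riesz represents it. -/
theorem exists_L2_representation {u : 𝓢'(ℝ, ℂ)} {D : Submodule ℂ 𝓢(ℝ, ℂ)} {M : ℝ} (hM : 0 ≤ M)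
    (h : ∀ φ ∈ D, ‖u φ‖ ≤ M * ‖φ.toLp 2‖) :
    ∃ v : Lp ℂ 2 (volume : Measure ℝ), ‖v‖ ≤ M ∧ ∀ φ ∈ D, u φ = (v : 𝓢'(ℝ, ℂ)) φ := by
  set J : 𝓢(ℝ, ℂ) →ₗ[ℂ] Lp ℂ 2 (volume : Measure ℝ) :=
    (SchwartzMap.toLpCLM ℂ ℂ 2 volume).toLinearMap
  have hinj : Function.Injective J := SchwartzMap.injective_toLp 2 volume
  let e := Submodule.equivMapOfInjective J hinj D
  let U : 𝓢(ℝ, ℂ) →ₗ[ℂ] ℂ := ⟨⟨u, map_add u⟩, fun c φ => map_smul u c φ⟩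
  let f : D.map J →ₗ[ℂ] ℂ := U ∘ₗ D.subtype ∘ₗ e.symm.toLinearMap
  have hf : ∀ φ : D, f (e φ) = u φ := by
    intro φ
    have : e.symm (e φ) = φ := e.symm_apply_apply φ
    change u (e.symm (e φ) : D) = u φ
    rw [this]
  have hb : ∀ x : D.map J, ‖f x‖ ≤ M * ‖x‖ := by
    intro x
    obtain ⟨φ, rfl⟩ := e.surjective x
    rw [hf]
    exact h φ φ.2
  obtain ⟨g, hg, hgn⟩ := exists_extension_norm_eq (D.map J) (f.mkContinuous M hb)
  set w := (InnerProductSpace.toDual ℂ (Lp ℂ 2 (volume : Measure ℝ))).symm g with hw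
  have hwn : ‖w‖ ≤ M := by
    rw [hw, LinearIsometryEquiv.norm_map, hgn]
    exact LinearMap.mkContinuous_norm_le _ hM _
  -- The Riesz representative pairs sesquilinearly; conjugating it gives the bilinear pairing.
  refine ⟨star w, (Lp.norm_le_norm_of_ae_le ?_).trans hwn, fun φ hφ => ?_⟩
  · filter_upwards [Lp.coeFn_star w] with x hx
    rw [hx, Pi.star_apply, norm_star]
  · have h1 : g (J φ) = u φ := (hg (e ⟨φ, hφ⟩)).trans (hf ⟨φ, hφ⟩)
    have h2 : g (J φ) = inner ℂ w (J φ) := by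
      rw [hw, InnerProductSpace.toDual_symm_apply]
    rw [← h1, h2, L2.inner_def, Lp.toTemperedDistribution_apply]
    refine integral_congr_ae ?_
    filter_upwards [Lp.coeFn_star w, φ.coeFn_toLp 2 volume] with x hx hx'
    rw [hx, Pi.star_apply]
    have : (J φ) x = φ x := hx'
    rw [this]
    simp

/-! ### Distributions that agree on mean-zero test functions -/

/-- The compactly supported test functions of integral zero. -/
def meanZeroTestFunctions : Submodule ℂ 𝓢(ℝ, ℂ) where
  carrier := {φ | HasCompactSupport φ ∧ ∫ x, φ x = 0}
  add_mem' := by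
    rintro φ ψ ⟨hφ, hφ0⟩ ⟨hψ, hψ0⟩
    refine ⟨hφ.add hψ, ?_⟩
    simp only [add_apply]
    rw [integral_add φ.integrable ψ.integrable, hφ0, hψ0, add_zero]
  zero_mem' := ⟨HasCompactSupport.zero, by simp⟩
  smul_mem' := by
    rintro c φ ⟨hφ, hφ0⟩
    refine ⟨hφ.smul_left (f := fun _ => c), ?_⟩
    simp only [smul_apply]
    rw [integral_smul, hφ0, smul_zero]

theorem constDistribution_apply (C : ℂ) (φ : 𝓢(ℝ, ℂ)) :
    constDistribution C φ = C * ∫ x, φ x := by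
  simp [constDistribution]

theorem exists_testFunction_integral_eq_one :
    ∃ φ : 𝓢(ℝ, ℂ), HasCompactSupport φ ∧ ∫ x, φ x = 1 := by
  have hc : HasCompactSupport fun x => (scaledBump 1 x : ℂ) :=
    (hasCompactSupport_scaledBump one_pos).comp_left (g := Complex.ofReal) rfl
  refine ⟨hc.toSchwartzMap (Complex.ofRealCLM.contDiff.comp (contDiff_scaledBump 1)), hc, ?_⟩
  change ∫ x, (scaledBump 1 x : ℂ) = 1
  rw [integral_complex_ofReal, integral_scaledBump one_pos, Complex.ofReal_one]

theorem exists_const_of_eq_on_meanZero {u v : 𝓢'(ℝ, ℂ)}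
    (h : ∀ φ ∈ meanZeroTestFunctions, u φ = v φ) : ∃ C : ℂ, u - constDistribution C = v := by
  obtain ⟨φ₀, hc, h1⟩ := exists_testFunction_integral_eq_one
  -- Any `φ` becomes mean-zero after subtracting `(∫ φ) φ₀`, so `u - v` is determined by its value
  -- at `φ₀`.
  refine ⟨u φ₀ - v φ₀, eq_of_eq_on_hasCompactSupport fun φ hφ => ?_⟩
  have hmem : φ + (-∫ x, φ x) • φ₀ ∈ meanZeroTestFunctions := by
    refine ⟨hφ.add (hc.smul_left (f := fun _ => -∫ x, φ x)), ?_⟩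
    have hi : Integrable fun x => (-∫ x, φ x) • φ₀ x := ((-∫ x, φ x) • φ₀).integrable
    simp only [add_apply, smul_apply]
    rw [integral_add φ.integrable hi, integral_smul, h1]
    simp
  have := h _ hmem
  simp only [map_add, map_smul, smul_eq_mul] at this
  have e : (u - constDistribution (u φ₀ - v φ₀)) φ =
      u φ - constDistribution (u φ₀ - v φ₀) φ := rfl
  rw [e, constDistribution_apply]
  linear_combination this

/-! ### Reality of the constant -/

theorem norm_toTemperedDistribution_apply_le (v : Lp ℂ 2 (volume : Measure ℝ)) {ψ : 𝓢(ℝ, ℂ)}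
    (hψ : ∀ x, (ψ x).im = 0) : ‖(v : 𝓢'(ℝ, ℂ)) ψ‖ ≤ ‖v‖ * ‖ψ.toLp 2‖ := by
  have e : (v : 𝓢'(ℝ, ℂ)) ψ = inner ℂ (ψ.toLp 2) v := by
    rw [Lp.toTemperedDistribution_apply, L2.inner_def]
    refine integral_congr_ae ?_
    filter_upwards [ψ.coeFn_toLp 2 volume] with x hx
    rw [hx, RCLike.inner_apply, Complex.conj_eq_iff_im.2 (hψ x), smul_eq_mul, mul_comm]
  rw [e, mul_comm]
  exact norm_inner_le_norm _ _

/-- On a real cutoff of width `R`, the imaginary part of `C` contributes linearly in `R`, while the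
`L²` part is only `O(√R)`; large `R` forces `C.im = 0`. -/
theorem im_eq_zero_of_isRealDistribution {u : 𝓢'(ℝ, ℂ)} {C : ℂ}
    {v : Lp ℂ 2 (volume : Measure ℝ)} (h : u - constDistribution C = (v : 𝓢'(ℝ, ℂ)))
    (hu : IsRealDistribution u) : C.im = 0 := by
  set I := ∫ x, cutoffBump x with hI
  have hI0 : 0 < I := cutoffBump.integral_pos
  have key : ∀ R : ℝ, 0 < R → |C.im| * (R * I) ≤ ‖v‖ * √(R * I) := by
    intro R hR
    let ψ : 𝓢(ℝ, ℂ) := (hasCompactSupport_cutoffSchwartz_scale hR).toSchwartzMap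
      ((cutoffSchwartz.smooth ⊤).comp (contDiff_const.mul contDiff_id))
    have hψ : ∀ x, ψ x = (cutoffBump (R⁻¹ * x) : ℂ) := fun x => rfl
    have him : ∀ x, (ψ x).im = 0 := fun x => by rw [hψ, Complex.ofReal_im]
    have hint : ∫ x, cutoffBump (R⁻¹ * x) = R * I := by
      rw [Measure.integral_comp_mul_left (fun x => cutoffBump x) R⁻¹, inv_inv, abs_of_pos hR,
        smul_eq_mul]
    have hintψ : ∫ x, ψ x = ((R * I : ℝ) : ℂ) := by
      simp only [hψ]
      rw [integral_complex_ofReal, hint]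
    have hnorm : ‖ψ.toLp 2‖ ≤ √(R * I) := by
      rw [SchwartzMap.norm_toLp' (by norm_num) (by norm_num), Real.sqrt_eq_rpow, one_div]
      simp only [ENNReal.toReal_ofNat]
      refine Real.rpow_le_rpow (integral_nonneg fun x => by positivity) ?_ (by norm_num)
      rw [← hint]
      have hi : Integrable fun x => cutoffBump (R⁻¹ * x) := by
        have := ψ.integrable (μ := volume).re
        exact this
      refine integral_mono_of_nonneg (Filter.Eventually.of_forall fun x => by positivity) hi
        (Filter.Eventually.of_forall fun x => ?_)
      have h0 : 0 ≤ cutoffBump (R⁻¹ * x) := cutoffBump.nonneg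
      have h1 : cutoffBump (R⁻¹ * x) ≤ 1 := cutoffBump.le_one
      simp only [hψ, Complex.norm_real, Real.norm_of_nonneg h0, Real.rpow_two]
      nlinarith
    have e : u ψ - C * ∫ x, ψ x = (v : 𝓢'(ℝ, ℂ)) ψ := by
      rw [← h, ← constDistribution_apply]
      rfl
    have e2 : (u ψ - C * ∫ x, ψ x).im = -(C.im * (R * I)) := by
      rw [Complex.sub_im, hu ψ him, hintψ, Complex.im_mul_ofReal]
      ring
    calc |C.im| * (R * I) = |(u ψ - C * ∫ x, ψ x).im| := by
          rw [e2, abs_neg, abs_mul, abs_of_pos (mul_pos hR hI0)]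
      _ ≤ ‖u ψ - C * ∫ x, ψ x‖ := Complex.abs_im_le_norm _
      _ ≤ ‖v‖ * ‖ψ.toLp 2‖ := by
        rw [e]
        exact norm_toTemperedDistribution_apply_le v him
      _ ≤ ‖v‖ * √(R * I) := by gcongr
  by_contra hC
  have hC0 : 0 < |C.im| := abs_pos.2 hC
  -- With `R * I = s²` the inequality reads `|C.im| s² ≤ ‖v‖ s`, contradicting `|C.im| s = ‖v‖ + 1`.
  set s := (‖v‖ + 1) / |C.im| with hs
  have hs0 : 0 < s := by positivity
  have hk := key (s ^ 2 / I) (by positivity)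
  rw [div_mul_cancel₀ _ hI0.ne', Real.sqrt_sq hs0.le] at hk
  have e : |C.im| * s = ‖v‖ + 1 := by rw [hs]; field_simp
  nlinarith

end

/-! ### The main theorem -/

theorem theorem4p1 :
    ∃ K : ℝ, 0 < K ∧
      ∀ (u : 𝓢'(ℝ, ℂ)) (F : Lp ℂ 1 offDiagMeasure), F ∈ L1od →
        fracGrad u = L1od.toDistribution F →
        ∃ (C : ℂ) (v : Lp ℂ 2 (volume : Measure ℝ)),
          u - constDistribution C = (v : 𝓢'(ℝ, ℂ)) ∧ ‖v‖ ≤ K * ‖F‖ ∧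
          (IsRealDistribution u → C.im = 0) := by
  obtain ⟨A, hA0, hA, hA'⟩ := exists_bound_scaledBump
  refine ⟨A ^ 2, by positivity, fun u F _ h => ?_⟩
  obtain ⟨v, hvn, hv⟩ := exists_L2_representation (u := u) (D := meanZeroTestFunctions)
    (M := A ^ 2 * ‖F‖) (by positivity) fun φ hφ => by
      rw [mul_right_comm]
      exact norm_apply_le_of_integral_eq_zero hA hA' h φ hφ.1 hφ.2
  obtain ⟨C, hC⟩ := exists_const_of_eq_on_meanZero hv
  exact ⟨C, v, hC, hvn, im_eq_zero_of_isRealDistribution hC⟩
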